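/- Let $X_1,X_2,\dots$ be independent real random variables with common continuous distribution function $F$, let $r\ge 1$ be an integer, $h(x_1,\dots,x_{r+1})=\max(x_1,\dots,x_{r+1})$, and let $\beta_r=\mathbb E\{X_1F(X_1)^r\}$. Suppose that $\mathbb E\,h(X_1,\dots,X_{r+1})^2<\infty$ and that $\sigma^2=\operatorname{Var}(g(X_1))>0$, where $g(x)=\mathbb E[h(X_1,\dots,X_{r+1})\mid X_1=x]-\beta_r$. Let $$\widehat\beta_r=\frac1{r+1}\binom n{r+1}^{-1}\sum_{1\le i_1<\dots<i_{r+1}\le n}h(X_{i_1},\dots,X_{i_{r+1}}),$$ let $\widehat\beta_{r,k}$ be the same estimator computed from the $n-1$ observations other than $X_k$, and let $\widehat V_k=n\widehat\beta_r-(n-1)\widehat\beta_{r,k}$, $k=1,\dots,n$, be the jackknife pseudo-values. Let $a_n>0$ be constants or random variables with $a_n=o_p(n^{2/3})$. Given a further pseudo-observation $\widehat V_{n+1}$, the adjusted jackknife empirical log-likelihood ratio is $$l_1(\beta_r)=\log\,\sup\Big\{\prod_{k=1}^{n+1}(n+1)p_k:\ p_k\ge0,\ \sum_{k=1}^{n+1}p_k=1,\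 \sum_{k=1}^{n+1}p_k(\widehat V_k-\beta_r)=0\Big\},$$ which equals $-\sum_{k=1}^{n+1}\log[1+\lambda_1(\widehat V_k-\beta_r)]$ whenever $\lambda_1$ satisfies $\sum_{k=1}^{n+1}\frac{\widehat V_k-\beta_r}{1+\lambda_1(\widehat V_k-\beta_r)}=0$ with all $1+\lambda_1(\widehat V_k-\beta_r)>0$. (i) If the added pseudo-observation is formed from the centred pseudo-values, that is, $\widehat V_{n+1}-\beta_r=-\frac{a_n}{n}\sum_{k=1}^n(\widehat V_k-\beta_r)$, then $-2\,l_1(\beta_r)$ converges in distribution to $\chi^2(1)$ as $n\to\infty$. (ii) If instead $\widehat V_{n+1}=-\frac{a_n}{n}\sum_{k=1}^n\widehat V_k$ without centring, then $-2\,l_1(\beta_r)$ converges in distribution to $\chi^2(1)$ as $n\to\infty$ provided that in addition $\beta_r\,a_n=o_p(n^{1/2})$ (no further condition if $\beta_r=0$). (Where the set in the supremum is empty, $l_1(\beta_r)$ is given the value $0$; this happens with probability tending to $0$.) -/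

import Mathlib

open MeasureTheory ProbabilityTheory Filter Finset

noncomputable section

/-- The maximum of the numbers `x i`, `i ∈ s` (`0` if `s` is empty). -/
def sampleMax {ι : Type*} (s : Finset ι) (x : ι → ℝ) : ℝ :=
  if h : s.Nonempty then s.sup' h x else 0

/-- The kernel `h (x_1, …, x_{r+1}) = max (x_1, …, x_{r+1})`. -/
def pwmKernel (r : ℕ) (x : Fin (r + 1) → ℝ) : ℝ := sampleMax Finset.univ x

/-- The probability weighted moment `β_r = E (X F(X)^r)` of the distribution `ν` on the line,
`F` being its distribution function. -/
def pwm (ν : Measure ℝ) (r : ℕ) : ℝ := ∫ x, x * (cdf ν x) ^ r ∂ν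

/-- `g x = E (h (X_1, …, X_{r+1}) | X_1 = x) - β_r` for independent `X_i` with distribution `ν`:
the first argument is frozen at `x`, the `r` others are integrated out. -/
def pwmProjection (ν : Measure ℝ) (r : ℕ) (x : ℝ) : ℝ :=
  (∫ y : Fin r → ℝ, pwmKernel r (Fin.cons x y) ∂(Measure.pi fun _ => ν)) - pwm ν r

/-- The U-statistic estimator of `β_r` computed from the observations `x i`, `i ∈ s`:
`1 / (r + 1)` times the average of the maximum over all `(r + 1)`-element subsets of `s`. -/
def pwmEstimator (r : ℕ) (s : Finset ℕ) (x : ℕ → ℝ) : ℝ :=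
  1 / ((r : ℝ) + 1) * (1 / ((s.card.choose (r + 1) : ℕ) : ℝ)) *
    ∑ t ∈ s.powersetCard (r + 1), sampleMax t x

/-- The jackknife pseudo-value `V_k = n β̂_r - (n - 1) β̂_{r,k}` of the sample
`x 0, …, x (n - 1)`, where `β̂_{r,k}` is the estimator without the `k`-th observation. -/
def pseudoValue (r n : ℕ) (x : ℕ → ℝ) (k : Fin n) : ℝ :=
  (n : ℝ) * pwmEstimator r (Finset.range n) x -
    ((n : ℝ) - 1) * pwmEstimator r ((Finset.range n).erase k) x

/-- The empirical likelihood ratio for mean zero of the numbers `z k`: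
the supremum of `∏ m p_k` over the probability vectors `p` with `∑ p_k z_k = 0`. -/
def elRatio {m : ℕ} (z : Fin m → ℝ) : ℝ :=
  sSup ((fun p : Fin m → ℝ => ∏ k, (m : ℝ) * p k) ''
    {p | (∀ k, 0 ≤ p k) ∧ ∑ k, p k = 1 ∧ ∑ k, p k * z k = 0})

/-- The adjusted empirical log-likelihood ratio at `b`: the logarithm of the empirical likelihood
ratio of the `n + 1` values `V_1 - b, …, V_n - b, v - b`, where `v` is the added
pseudo-observation. -/
def adjLogRatio {n : ℕ} (V : Fin n → ℝ) (v b : ℝ) : ℝ :=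
  Real.log (elRatio fun k : Fin (n + 1) => (Fin.snoc V v : Fin (n + 1) → ℝ) k - b)

/-- The added pseudo-observation `- (a / n) ∑ V_k`. -/
def addedValue {n : ℕ} (a : ℝ) (V : Fin n → ℝ) : ℝ := -(a / n) * ∑ k, V k

/-- The added pseudo-observation formed from the centred values `V_k - b`: it is the `v` with
`v - b = - (a / n) ∑ (V_k - b)`. -/
def centredAddedValue {n : ℕ} (a b : ℝ) (V : Fin n → ℝ) : ℝ :=
  b + addedValue a (fun k => V k - b)

/-- If `lam` solves the multiplier equation, with all weights positive, the logarithm of the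
empirical likelihood ratio is `- ∑ log (1 + lam z_k)`. -/
theorem log_elRatio_eq {m : ℕ} (hm : 0 < m) (z : Fin m → ℝ) (lam : ℝ)
    (hpos : ∀ k, 0 < 1 + lam * z k)
    (hlam : 1 / (m : ℝ) * ∑ k, z k / (1 + lam * z k) = 0) :
    Real.log (elRatio z) = -∑ k, Real.log (1 + lam * z k) := by
  have hm' : (0 : ℝ) < m := by exact_mod_cast hm
  have hs : ∑ k, z k / (1 + lam * z k) = 0 := by
    rcases mul_eq_zero.1 hlam with h | h
    · exact absurd h (by positivity)
    · exact h
  have hone : ∑ k, 1 / (1 + lam * z k) = (m : ℝ) := by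
    have h1 : ∀ k, 1 / (1 + lam * z k) = 1 - lam * (z k / (1 + lam * z k)) := by
      intro k
      have := (hpos k).ne'
      field_simp
      ring
    rw [Finset.sum_congr rfl fun k _ => h1 k, Finset.sum_sub_distrib, ← Finset.mul_sum, hs]
    simp
  have hmax : IsGreatest ((fun p : Fin m → ℝ => ∏ k, (m : ℝ) * p k) ''
      {p | (∀ k, 0 ≤ p k) ∧ ∑ k, p k = 1 ∧ ∑ k, p k * z k = 0})
      (∏ k, (1 + lam * z k)⁻¹) := by
    constructor
    · refine ⟨fun k => 1 / (m : ℝ) * (1 + lam * z k)⁻¹, ⟨?_, ?_, ?_⟩, ?_⟩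
      · intro k
        have := hpos k
        positivity
      · rw [← Finset.mul_sum]
        simp only [one_div] at hone ⊢
        rw [hone, inv_mul_cancel₀ hm'.ne']
      · rw [← hlam, Finset.mul_sum]
        refine Finset.sum_congr rfl fun k _ => ?_
        rw [div_eq_mul_inv (z k)]
        ring
      · refine Finset.prod_congr rfl fun k _ => ?_
        field_simp
    · rintro _ ⟨p, ⟨hp0, hp1, hpz⟩, rfl⟩
      have hle : ∏ k, ((m : ℝ) * p k * (1 + lam * z k)) ≤ 1 := by
        have hw : ∑ _k : Fin m, (1 / (m : ℝ)) = 1 := by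
          simp [hm'.ne']
        have hq : ∀ k ∈ (Finset.univ : Finset (Fin m)), 0 ≤ (m : ℝ) * p k * (1 + lam * z k) :=
          fun k _ => mul_nonneg (mul_nonneg hm'.le (hp0 k)) (hpos k).le
        have h := Real.geom_mean_le_arith_mean_weighted Finset.univ (fun _ => 1 / (m : ℝ))
          (fun k => (m : ℝ) * p k * (1 + lam * z k)) (fun _ _ => by positivity) hw hq
        have hsum : ∑ k, 1 / (m : ℝ) * ((m : ℝ) * p k * (1 + lam * z k)) = 1 := by
          have h2 : ∀ k, 1 / (m : ℝ) * ((m : ℝ) * p k * (1 + lam * z k)) =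
              p k + lam * (p k * z k) := by
            intro k
            field_simp
          rw [Finset.sum_congr rfl fun k _ => h2 k, Finset.sum_add_distrib, ← Finset.mul_sum,
            hp1, hpz]
          ring
        rw [hsum, Real.finsetProd_rpow _ _ hq] at h
        by_contra! hc
        exact absurd h (not_le.2 (Real.one_lt_rpow hc (by positivity)))
      have hP : 0 < ∏ k, (1 + lam * z k) := Finset.prod_pos fun k _ => hpos k
      rw [Finset.prod_mul_distrib] at hle
      rw [Finset.prod_inv_distrib]
      rw [← one_div]
      exact (le_div_iff₀ hP).2 hle
  rw [elRatio, hmax.csSup_eq, Finset.prod_inv_distrib, Real.log_inv,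
    Real.log_prod fun k _ => (hpos k).ne']

end

/-! The kernel has a Hoeffding decomposition: a constant, plus a sum of one-variable terms
`centredProjection`, plus a remainder that integrates to zero over all but one of its arguments. The
jackknife is linear in the kernel and recovers the first two parts exactly, so `V_k - β = g (X_k) +
R_k` with `g` the centred projection and `R_k` the pseudo-value of the remainder (`pseudoValue_eq`).
Remainders at index sets with at most one common index are uncorrelated
(`integral_sampleRemainder_mul_eq_zero`), so second moments reduce to counting pairs of subsets that
overlap more. This gives `E R_k ^ 2 = O(1 / n)` and `E (∑ R_k) ^ 2 = O(1)`: after division by `√n`,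
neither the sum nor the sum of squares of the `V_k - β` feels the `R_k` in the limit.

The likelihood part is deterministic. For numbers `w_k` with sum `T`, sum of squares `S` and modulus
at most `M`, the multiplier is close to `T / S` and `-2 log` of the ratio is `T ^ 2 / S`, with an
error controlled by `M` (`abs_neg_two_mul_log_elRatio_sub_le`). The ratio is invariant under
scaling, so all values may be divided by `√n`. The added value then becomes `-α ∑ (V_k - β) / √n -
b` with `α = a_n / n`. Since the normalized sum is tight, this is `o_p(1)` and perturbs `T`, `S` and
`M` negligibly. The growth condition on `a_n` enters only through `a_n / n → 0`. Centring gives `b =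
0`; without it `b = β a_n / √n + β / √n`, which is the source of the extra condition in (ii).

The law of large numbers for `g (X_k) ^ 2` yields `S → σ²` and `M → 0`. The error bound is
continuous and vanishes at the limiting values, so the statistic differs from `(∑ g (X_k)) ^ 2 / (n
σ²)` by `o_p(1)`, and the central limit theorem finishes the proof. -/

/-! ### Scale invariance and measurability of the empirical likelihood ratio. -/

theorem elRatio_div_const {m : ℕ} (z : Fin m → ℝ) {c : ℝ} (hc : c ≠ 0) :
    elRatio (fun k => z k / c) = elRatio z := by
  have h : ∀ p : Fin m → ℝ, ∑ k, p k * (z k / c) = 0 ↔ ∑ k, p k * z k = 0 := by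
    intro p
    simp_rw [← mul_div_assoc, ← Finset.sum_div]
    simp [hc]
  simp only [elRatio, h]

/-- The supremum is attained, by compactness of the simplex, so the set is the projection of a
closed set along a compact factor. Positivity of `c` excludes the points with no admissible weights,
where the supremum is `0` by convention. -/
theorem isClosed_setOf_le_elRatio {m : ℕ} {c : ℝ} (hc : 0 < c) :
    IsClosed {z : Fin m → ℝ | c ≤ elRatio z} := by
  have hK : CompactSpace (stdSimplex ℝ (Fin m)) :=
    isCompact_iff_compactSpace.1 (isCompact_stdSimplex ℝ (Fin m))
  have hset : {z : Fin m → ℝ | c ≤ elRatio z} = Prod.snd ''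
      {q : stdSimplex ℝ (Fin m) × (Fin m → ℝ) |
        ∑ k, q.1.1 k * q.2 k = 0 ∧ c ≤ ∏ k, (m : ℝ) * q.1.1 k} := by
    ext z
    have hcpt : IsCompact ((fun p : Fin m → ℝ => ∏ k, (m : ℝ) * p k) ''
        {p | (∀ k, 0 ≤ p k) ∧ ∑ k, p k = 1 ∧ ∑ k, p k * z k = 0}) := by
      refine IsCompact.image ?_ (by fun_prop)
      have : {p : Fin m → ℝ | (∀ k, 0 ≤ p k) ∧ ∑ k, p k = 1 ∧ ∑ k, p k * z k = 0} =
          stdSimplex ℝ (Fin m) ∩ {p | ∑ k, p k * z k = 0} := by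
        ext p
        simp [stdSimplex, and_assoc]
      rw [this]
      exact (isCompact_stdSimplex ℝ (Fin m)).inter_right
        (isClosed_eq (by fun_prop) continuous_const)
    simp only [Set.mem_ofPred_eq, Set.mem_image, Prod.exists, exists_eq_right]
    constructor
    · intro h
      have hne : ((fun p : Fin m → ℝ => ∏ k, (m : ℝ) * p k) ''
          {p | (∀ k, 0 ≤ p k) ∧ ∑ k, p k = 1 ∧ ∑ k, p k * z k = 0}).Nonempty := by
        by_contra hemp
        rw [Set.not_nonempty_iff_eq_empty] at hemp
        rw [elRatio, hemp, Real.sSup_empty] at h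
        exact absurd h (not_le.2 hc)
      obtain ⟨p, ⟨h0, h1, h2⟩, hp⟩ := hcpt.sSup_mem hne
      refine ⟨⟨p, h0, h1⟩, h2, ?_⟩
      rw [elRatio, ← hp] at h
      exact h
    · rintro ⟨p, h2, h⟩
      exact h.trans (le_csSup hcpt.bddAbove ⟨p.1, ⟨p.2.1, p.2.2, h2⟩, rfl⟩)
  rw [hset]
  have hp : ∀ k, Continuous fun q : stdSimplex ℝ (Fin m) × (Fin m → ℝ) => q.1.1 k :=
    fun k => (continuous_apply k).comp (continuous_subtype_val.comp continuous_fst)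
  refine isClosedMap_snd_of_compactSpace _ (IsClosed.inter ?_ ?_)
  · exact isClosed_eq (continuous_finsetSum _ fun k _ => (hp k).mul (by fun_prop))
      continuous_const
  · exact isClosed_le continuous_const
      (continuous_finsetProd _ fun k _ => continuous_const.mul (hp k))

theorem elRatio_nonneg {m : ℕ} (z : Fin m → ℝ) : 0 ≤ elRatio z := by
  refine Real.sSup_nonneg ?_
  rintro _ ⟨p, hp, rfl⟩
  exact Finset.prod_nonneg fun k _ => mul_nonneg (Nat.cast_nonneg m) (hp.1 k)

theorem measurable_elRatio {m : ℕ} : Measurable (elRatio : (Fin m → ℝ) → ℝ) := by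
  refine measurable_of_Ici fun c => ?_
  rcases le_or_gt c 0 with hc | hc
  · convert MeasurableSet.univ
    ext z
    simpa using hc.trans (elRatio_nonneg z)
  · exact (isClosed_setOf_le_elRatio hc).measurableSet

/-! ### The Lagrange multiplier and the quadratic expansion. -/

section Multiplier

variable {ι : Type*} [Fintype ι]

/-- Intermediate value theorem on `[0, 2T / S]`. The smallness condition keeps `|θ w k| ≤ 1 / 2`
there, so no denominator vanishes; the left side is `T ≥ 0` at `0` and at most `-T / 3` at the other
end. -/
theorem exists_multiplier_of_nonneg (w : ι → ℝ) {M : ℝ} (hM : ∀ k, |w k| ≤ M)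
    (hS : 0 < ∑ k, w k ^ 2) (hT : 0 ≤ ∑ k, w k)
    (hsmall : 4 * M * (∑ k, w k) ≤ ∑ k, w k ^ 2) :
    ∃ θ, 0 ≤ θ ∧ θ ≤ 2 * (∑ k, w k) / ∑ k, w k ^ 2 ∧ ∑ k, w k / (1 + θ * w k) = 0 := by
  set T := ∑ k, w k with hTdef
  set S := ∑ k, w k ^ 2 with hSdef
  set t := 2 * T / S with ht
  have ht0 : 0 ≤ t := by positivity
  have htS : t * S = 2 * T := by rw [ht]; field_simp
  have htM : t * M ≤ 1 / 2 := by
    rw [ht, div_mul_eq_mul_div, div_le_iff₀ hS]; linarith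
  have hbd : ∀ θ, 0 ≤ θ → θ ≤ t → ∀ k, |θ * w k| ≤ 1 / 2 := by
    intro θ h0 h1 k
    rw [abs_mul, abs_of_nonneg h0]
    have := hM k
    have := abs_nonneg (w k)
    nlinarith
  have hcont : ContinuousOn (fun θ : ℝ => ∑ k, w k / (1 + θ * w k)) (Set.Icc 0 t) := by
    refine continuousOn_finsetSum _ fun k _ => ?_
    refine ContinuousOn.div continuousOn_const (by fun_prop) ?_
    intro θ hθ
    have := abs_le.1 (hbd θ hθ.1 hθ.2 k)
    linarith [this.1]
  have hend : ∑ k, w k / (1 + t * w k) ≤ 0 := by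
    -- The factor `2 / 3` is the value of `1 / (1 + x)` at `x = 1 / 2`, the largest `t * w k`
    -- possible.
    have h1 : ∀ k, w k / (1 + t * w k) ≤ w k - t * (2 / 3) * w k ^ 2 := by
      intro k
      have := abs_le.1 (hbd t ht0 le_rfl k)
      have hp : 0 < 1 + t * w k := by linarith [this.1]
      rw [div_le_iff₀ hp]
      have h2 : 0 ≤ t * w k ^ 2 := by positivity
      nlinarith [mul_nonneg h2 (by linarith [this.2] : 0 ≤ 1 / 2 - t * w k)]
    refine (Finset.sum_le_sum fun k _ => h1 k).trans ?_
    rw [Finset.sum_sub_distrib, ← Finset.mul_sum, ← hTdef, ← hSdef]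
    nlinarith
  have hiv := intermediate_value_Icc' ht0 hcont
  have hmem : (0 : ℝ) ∈ Set.Icc (∑ k, w k / (1 + t * w k)) (∑ k, w k / (1 + 0 * w k)) := by
    refine ⟨hend, ?_⟩
    simpa using hT
  obtain ⟨θ, hθ, hz⟩ := hiv hmem
  exact ⟨θ, hθ.1, hθ.2, hz⟩

theorem exists_multiplier (w : ι → ℝ) {M : ℝ} (hM : ∀ k, |w k| ≤ M)
    (hS : 0 < ∑ k, w k ^ 2) (hsmall : 4 * M * |∑ k, w k| ≤ ∑ k, w k ^ 2) :
    ∃ θ, |θ| ≤ 2 * |∑ k, w k| / ∑ k, w k ^ 2 ∧ ∑ k, w k / (1 + θ * w k) = 0 := by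
  rcases le_total 0 (∑ k, w k) with hT | hT
  · rw [abs_of_nonneg hT] at hsmall ⊢
    obtain ⟨θ, h0, h1, h2⟩ := exists_multiplier_of_nonneg w hM hS hT hsmall
    exact ⟨θ, by rwa [abs_of_nonneg h0], h2⟩
  · rw [abs_of_nonpos hT] at hsmall ⊢
    obtain ⟨θ, h0, h1, h2⟩ := exists_multiplier_of_nonneg (fun k => - w k) (M := M)
      (by simpa using hM) (by simpa using hS) (by simpa using hT)
      (by simpa using hsmall)
    refine ⟨-θ, by simpa [abs_of_nonneg h0] using h1, ?_⟩
    simpa [neg_div] using h2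

theorem abs_log_one_add_sub_le {x : ℝ} (hx : |x| ≤ 1 / 2) :
    |Real.log (1 + x) - (x - x ^ 2 / 2)| ≤ 2 * |x| ^ 3 := by
  have h := Real.abs_log_sub_add_sum_range_le (x := -x) (by rw [abs_neg]; linarith) 2
  simp only [Finset.sum_range_succ, Finset.sum_range_zero, abs_neg] at h
  have h2 : |x| ^ 3 / (1 - |x|) ≤ 2 * |x| ^ 3 := by
    rw [div_le_iff₀ (by linarith)]
    nlinarith [pow_nonneg (abs_nonneg x) 3]
  refine le_trans (le_of_eq ?_) (h.trans h2)
  congr 1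
  norm_num
  ring

/-- The quadratic approximation of the empirical log-likelihood ratio for mean zero. -/
theorem abs_neg_two_mul_log_elRatio_sub_le {m : ℕ} (hm : 0 < m) (w : Fin m → ℝ) {M : ℝ}
    (hM : ∀ k, |w k| ≤ M) (hS : 0 < ∑ k, w k ^ 2)
    (hsmall : 4 * M * |∑ k, w k| ≤ ∑ k, w k ^ 2) :
    |-2 * Real.log (elRatio w) - (∑ k, w k) ^ 2 / ∑ k, w k ^ 2| ≤
      64 * |∑ k, w k| ^ 4 * M ^ 2 / (∑ k, w k ^ 2) ^ 3 +
        32 * |∑ k, w k| ^ 3 * M / (∑ k, w k ^ 2) ^ 2 := by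
  obtain ⟨θ, hθ, hz⟩ := exists_multiplier w hM hS hsmall
  have hM0 : 0 ≤ M := (abs_nonneg _).trans (hM ⟨0, hm⟩)
  set T := ∑ k, w k with hTdef
  set S := ∑ k, w k ^ 2 with hSdef
  have hθM : |θ| * M ≤ 1 / 2 := by
    refine (mul_le_mul_of_nonneg_right hθ hM0).trans ?_
    rw [div_mul_eq_mul_div, div_le_iff₀ hS]; linarith
  have hbd : ∀ k, |θ * w k| ≤ 1 / 2 := by
    intro k
    rw [abs_mul]
    exact (mul_le_mul_of_nonneg_left (hM k) (abs_nonneg _)).trans hθM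
  have hpos : ∀ k, 1 / 2 ≤ 1 + θ * w k := fun k => by linarith [(abs_le.1 (hbd k)).1]
  have hcube : ∑ k, |w k| ^ 3 ≤ M * S := by
    rw [hSdef, Finset.mul_sum]
    refine Finset.sum_le_sum fun k _ => ?_
    rw [pow_succ, sq_abs, mul_comm]
    exact mul_le_mul_of_nonneg_right (hM k) (sq_nonneg _)
  rw [log_elRatio_eq hm w θ (fun k => by linarith [hpos k]) (by rw [hz, mul_zero])]
  -- Expanding `w / (1 + θ w)` to second order in the multiplier equation shows `θ ≈ T / S`.
  have hlin : |T - θ * S| ≤ 2 * θ ^ 2 * (M * S) := by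
    have h1 : T - θ * S = -∑ k, θ ^ 2 * (w k ^ 3 / (1 + θ * w k)) := by
      have h2 : ∀ k, w k / (1 + θ * w k) =
          w k - θ * w k ^ 2 + θ ^ 2 * (w k ^ 3 / (1 + θ * w k)) := by
        intro k
        have hd : 1 + θ * w k ≠ 0 := by linarith [hpos k]
        rw [div_eq_iff hd]
        linear_combination -θ ^ 2 * div_mul_cancel₀ (w k ^ 3) hd
      rw [Finset.sum_congr rfl fun k _ => h2 k, Finset.sum_add_distrib, Finset.sum_sub_distrib,
        ← Finset.mul_sum, ← hTdef, ← hSdef] at hz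
      linarith
    rw [h1, abs_neg]
    refine (Finset.abs_sum_le_sum_abs _ _).trans ?_
    have h3 : ∀ k, |θ ^ 2 * (w k ^ 3 / (1 + θ * w k))| ≤ 2 * θ ^ 2 * |w k| ^ 3 := by
      intro k
      have hp : 0 < 1 + θ * w k := by linarith [hpos k]
      rw [abs_mul, abs_div, abs_of_pos hp, abs_pow (w k), abs_of_nonneg (sq_nonneg θ)]
      have : |w k| ^ 3 / (1 + θ * w k) ≤ 2 * |w k| ^ 3 := by
        rw [div_le_iff₀ hp]
        nlinarith [hpos k, pow_nonneg (abs_nonneg (w k)) 3]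
      nlinarith [sq_nonneg θ]
    refine (Finset.sum_le_sum fun k _ => h3 k).trans ?_
    rw [← Finset.mul_sum]
    exact mul_le_mul_of_nonneg_left hcube (by positivity)
  have hlog : |∑ k, Real.log (1 + θ * w k) - (θ * T - θ ^ 2 * S / 2)| ≤
      2 * |θ| ^ 3 * (M * S) := by
    have h1 : θ * T - θ ^ 2 * S / 2 = ∑ k, (θ * w k - (θ * w k) ^ 2 / 2) := by
      rw [Finset.sum_sub_distrib, hTdef, hSdef, Finset.mul_sum, Finset.mul_sum, Finset.sum_div]
      simp only [mul_pow]
    rw [h1, ← Finset.sum_sub_distrib]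
    refine (Finset.abs_sum_le_sum_abs _ _).trans ?_
    refine (Finset.sum_le_sum fun k _ => abs_log_one_add_sub_le (hbd k)).trans ?_
    simp only [abs_mul, mul_pow]
    rw [← Finset.mul_sum, ← Finset.mul_sum, ← mul_assoc]
    exact mul_le_mul_of_nonneg_left hcube (by positivity)
  -- Completing the square: the error in `θ ≈ T / S` enters only quadratically.
  have hquad : 2 * (θ * T - θ ^ 2 * S / 2) - T ^ 2 / S = -((T - θ * S) ^ 2 / S) := by
    field_simp
    ring
  have hsq : (T - θ * S) ^ 2 / S ≤ 4 * |θ| ^ 4 * M ^ 2 * S := by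
    rw [div_le_iff₀ hS, ← sq_abs]
    refine (pow_le_pow_left₀ (abs_nonneg _) hlin 2).trans (le_of_eq ?_)
    rw [← sq_abs θ]
    ring
  -- Inserting `|θ| ≤ 2 |T| / S` turns the coefficients `4` into `64 = 4 * 2 ^ 4` and, below, `32 =
  -- 4 * 2 ^ 3`.
  have hb1 : 4 * |θ| ^ 4 * M ^ 2 * S ≤ 64 * |T| ^ 4 * M ^ 2 / S ^ 3 := by
    have := pow_le_pow_left₀ (abs_nonneg _) hθ 4
    calc 4 * |θ| ^ 4 * M ^ 2 * S ≤ 4 * (2 * |T| / S) ^ 4 * M ^ 2 * S := by gcongr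
      _ = _ := by field_simp; ring
  have hb2 : 4 * |θ| ^ 3 * (M * S) ≤ 32 * |T| ^ 3 * M / S ^ 2 := by
    calc 4 * |θ| ^ 3 * (M * S) ≤ 4 * (2 * |T| / S) ^ 3 * (M * S) := by gcongr
      _ = _ := by field_simp; ring
  have hsplit : -2 * -∑ k, Real.log (1 + θ * w k) - T ^ 2 / S =
      2 * (∑ k, Real.log (1 + θ * w k) - (θ * T - θ ^ 2 * S / 2)) + -((T - θ * S) ^ 2 / S) := by
    rw [← hquad]; ring
  rw [hsplit]
  refine (abs_add_le _ _).trans ?_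
  rw [abs_neg, abs_of_nonneg (by positivity : 0 ≤ (T - θ * S) ^ 2 / S), abs_mul, abs_two]
  linarith

end Multiplier

/-! ### Algebra of U-statistics and their jackknife pseudo-values. -/

/-- The U-statistic with kernel `φ`: the mean of `φ t` over the `m`-element subsets `t` of `s`. -/
noncomputable def uStat (m : ℕ) (s : Finset ℕ) (φ : Finset ℕ → ℝ) : ℝ :=
  (∑ t ∈ s.powersetCard m, φ t) / (s.card.choose m : ℝ)

/-- The jackknife pseudo-value, at `k`, of the statistic `uStat (r + 1) · φ / (r + 1)`. -/
noncomputable def jackknife (r n : ℕ) (φ : Finset ℕ → ℝ) (k : ℕ) : ℝ :=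
  ((n : ℝ) * uStat (r + 1) (range n) φ -
    ((n : ℝ) - 1) * uStat (r + 1) ((range n).erase k) φ) / ((r : ℝ) + 1)

theorem pseudoValue_eq_jackknife (r n : ℕ) (x : ℕ → ℝ) (k : Fin n) :
    pseudoValue r n x k = jackknife r n (fun t => sampleMax t x) k := by
  simp only [pseudoValue, pwmEstimator, jackknife, uStat]
  ring

theorem uStat_add (m : ℕ) (s : Finset ℕ) (φ ψ : Finset ℕ → ℝ) :
    uStat m s (fun t => φ t + ψ t) = uStat m s φ + uStat m s ψ := by
  simp only [uStat, sum_add_distrib, add_div]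

theorem jackknife_add (r n : ℕ) (φ ψ : Finset ℕ → ℝ) (k : ℕ) :
    jackknife r n (fun t => φ t + ψ t) k = jackknife r n φ k + jackknife r n ψ k := by
  simp only [jackknife, uStat_add]
  ring

theorem uStat_const {m : ℕ} {s : Finset ℕ} (h : m ≤ s.card) (c : ℝ) :
    uStat m s (fun _ => c) = c := by
  have : (s.card.choose m : ℝ) ≠ 0 := by exact_mod_cast (Nat.choose_pos h).ne'
  simp [uStat, card_powersetCard, this]

theorem card_filter_mem_powersetCard {s : Finset ℕ} {q i : ℕ} (hi : i ∈ s) :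
    ((s.powersetCard (q + 1)).filter (i ∈ ·)).card = (s.card - 1).choose q := by
  have h := card_filter_powersetCard_subset {i} s (q + 1) (by simpa using hi) (by simp)
  simpa using h

theorem card_filter_mem_mem_powersetCard {s : Finset ℕ} {q i j : ℕ} (hi : i ∈ s) (hj : j ∈ s)
    (hij : i ≠ j) :
    ((s.powersetCard (q + 2)).filter fun t => i ∈ t ∧ j ∈ t).card = (s.card - 2).choose q := by
  have h := card_filter_powersetCard_subset {i, j} s (q + 2)
    (by simp [insert_subset_iff, hi, hj]) (by simp [card_pair hij])
  simpa [card_pair hij, insert_subset_iff] using h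

/-- Double counting: every index lies in the same number of `(r + 1)`-subsets. -/
theorem uStat_sum {r : ℕ} {s : Finset ℕ} (h : r + 1 ≤ s.card) (g : ℕ → ℝ) :
    uStat (r + 1) s (fun t => ∑ i ∈ t, g i) = ((r : ℝ) + 1) / s.card * ∑ i ∈ s, g i := by
  have h1 : ∑ t ∈ s.powersetCard (r + 1), ∑ i ∈ t, g i =
      ((s.card - 1).choose r : ℝ) * ∑ i ∈ s, g i := by
    rw [sum_comm' (t' := s) (s' := fun i => (s.powersetCard (r + 1)).filter (i ∈ ·)), mul_sum]
    · refine sum_congr rfl fun i hi => ?_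
      rw [sum_const, card_filter_mem_powersetCard hi, nsmul_eq_mul]
    · intro t i
      simp only [mem_filter]
      constructor
      · rintro ⟨ht, hi⟩
        exact ⟨⟨ht, hi⟩, (mem_powersetCard.1 ht).1 hi⟩
      · rintro ⟨⟨ht, hi⟩, -⟩
        exact ⟨ht, hi⟩
  obtain ⟨N, hN⟩ : ∃ N, s.card = N + 1 := ⟨s.card - 1, by omega⟩
  have h2 : ((N : ℝ) + 1) * (N.choose r : ℝ) = ((N + 1).choose (r + 1) : ℝ) * ((r : ℝ) + 1) := by
    exact_mod_cast Nat.add_one_mul_choose_eq N r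
  have h3 : ((N + 1).choose (r + 1) : ℝ) ≠ 0 := by
    exact_mod_cast (Nat.choose_pos (by omega)).ne'
  rw [uStat, h1, hN, Nat.add_sub_cancel]
  push_cast
  have h4 : (N : ℝ) + 1 ≠ 0 := by positivity
  rw [div_eq_iff h3, div_mul_eq_mul_div, div_mul_eq_mul_div, eq_div_iff h4]
  linear_combination (∑ i ∈ s, g i) * h2

theorem jackknife_const {r n k : ℕ} (hn : r + 2 ≤ n) (hk : k < n) (c : ℝ) :
    jackknife r n (fun _ => c) k = c / ((r : ℝ) + 1) := by
  rw [jackknife, uStat_const (by simp; omega), uStat_const]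
  · ring
  · rw [card_erase_of_mem (by simpa using hk)]; simp; omega

/-- On additive kernels the statistic is a sample mean, and the pseudo-values of a sample mean are
the observations. The bound on `n` leaves at least `r + 1` indices after deletion. -/
theorem jackknife_sum {r n k : ℕ} (hn : r + 2 ≤ n) (hk : k < n) (g : ℕ → ℝ) :
    jackknife r n (fun t => ∑ i ∈ t, g i) k = g k := by
  have hk' : k ∈ range n := by simpa using hk
  have hcard : ((range n).erase k).card = n - 1 := by rw [card_erase_of_mem hk', card_range]
  rw [jackknife, uStat_sum (by simp; omega), uStat_sum (by rw [hcard]; omega), hcard, card_range,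
    ← add_sum_erase _ _ hk']
  obtain ⟨N, rfl⟩ : ∃ N, n = N + 2 := ⟨n - 2, by omega⟩
  rw [show N + 2 - 1 = N + 1 from rfl]
  push_cast
  have h1 : (N : ℝ) + 2 ≠ 0 := by positivity
  have h2 : (N : ℝ) + 1 ≠ 0 := by positivity
  have h3 : (r : ℝ) + 1 ≠ 0 := by positivity
  rw [show (N : ℝ) + 2 - 1 = N + 1 by ring]
  field_simp
  ring

theorem sum_powersetCard_insert {s : Finset ℕ} {k : ℕ} (hk : k ∉ s) (r : ℕ)
    (φ : Finset ℕ → ℝ) :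
    ∑ t ∈ (insert k s).powersetCard (r + 1), φ t =
      ∑ t ∈ s.powersetCard (r + 1), φ t + ∑ t ∈ s.powersetCard r, φ (insert k t) := by
  rw [powersetCard_succ_insert hk, sum_union, sum_image]
  · intro a ha b hb hab
    have ha' : k ∉ a := fun h => hk ((mem_powersetCard.1 ha).1 h)
    have hb' : k ∉ b := fun h => hk ((mem_powersetCard.1 hb).1 h)
    rw [← erase_insert ha', ← erase_insert hb', hab]
  · rw [disjoint_left]
    rintro t ht ht'
    obtain ⟨u, -, rfl⟩ := mem_image.1 ht'
    exact hk ((mem_powersetCard.1 ht).1 (mem_insert_self k u))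

/-- The pseudo-value in terms of the subsets that do and that do not contain `k`. -/
theorem jackknife_eq {r n k : ℕ} (hn : r + 2 ≤ n) (hk : k < n) (φ : Finset ℕ → ℝ) :
    jackknife r n φ k = uStat r ((range n).erase k) (fun t => φ (insert k t)) -
      (r : ℝ) / ((r : ℝ) + 1) * uStat (r + 1) ((range n).erase k) φ := by
  have hk' : k ∈ range n := by simpa using hk
  have hcard : ((range n).erase k).card = n - 1 := by rw [card_erase_of_mem hk', card_range]
  have hsum := sum_powersetCard_insert (notMem_erase k (range n)) r φ
  rw [insert_erase hk'] at hsum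
  simp only [jackknife, uStat, hsum, hcard, card_range]
  obtain ⟨N, rfl⟩ : ∃ N, n = N + r + 2 := ⟨n - (r + 2), by omega⟩
  rw [show N + r + 2 - 1 = N + r + 1 from rfl]
  have e1 : ((N + r + 1 : ℝ) + 1) * ((N + r + 1).choose r : ℝ) =
      ((N + r + 2).choose (r + 1) : ℝ) * ((r : ℝ) + 1) := by
    exact_mod_cast Nat.add_one_mul_choose_eq (N + r + 1) r
  have e2 : ((N + r + 1).choose (r + 1) : ℝ) * ((r : ℝ) + 1) =
      ((N + r + 1).choose r : ℝ) * ((N : ℝ) + 1) := by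
    have := Nat.choose_succ_right_eq (N + r + 1) r
    rw [show N + r + 1 - r = N + 1 by omega] at this
    exact_mod_cast this
  have p1 : ((N + r + 1).choose r : ℝ) ≠ 0 := by
    exact_mod_cast (Nat.choose_pos (by omega)).ne'
  have h3 : (r : ℝ) + 1 ≠ 0 := by positivity
  have h4 : (N : ℝ) + 1 ≠ 0 := by positivity
  have h5 : (N : ℝ) + r + 2 ≠ 0 := by positivity
  have e1' : ((N + r + 2).choose (r + 1) : ℝ) =
      (N + r + 2) * ((N + r + 1).choose r : ℝ) / ((r : ℝ) + 1) := by
    rw [eq_div_iff h3, ← e1]; ring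
  have e2' : ((N + r + 1).choose (r + 1) : ℝ) =
      ((N + r + 1).choose r : ℝ) * ((N : ℝ) + 1) / ((r : ℝ) + 1) := by
    rw [eq_div_iff h3, e2]
  rw [e1', e2']
  push_cast
  field_simp
  ring

/-- The mean of the pseudo-values is the statistic itself. -/
theorem sum_jackknife {r n : ℕ} (hn : r + 2 ≤ n) (φ : Finset ℕ → ℝ) :
    ∑ k ∈ range n, jackknife r n φ k = n * uStat (r + 1) (range n) φ / ((r : ℝ) + 1) := by
  -- Each `t` survives the deletion of exactly the `n - (r + 1)` indices outside it.
  have hdel : ∑ k ∈ range n, ∑ t ∈ ((range n).erase k).powersetCard (r + 1), φ t =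
      ((n : ℝ) - (r + 1)) * ∑ t ∈ (range n).powersetCard (r + 1), φ t := by
    rw [sum_comm' (t' := (range n).powersetCard (r + 1)) (s' := fun t => range n \ t), mul_sum]
    · refine sum_congr rfl fun t ht => ?_
      obtain ⟨ht1, ht2⟩ := mem_powersetCard.1 ht
      rw [sum_const, card_sdiff_of_subset ht1, card_range, ht2, nsmul_eq_mul,
        Nat.cast_sub (by omega)]
      push_cast
      ring
    · intro k t
      have h : k ∈ range n \ t ↔ k ∈ range n ∧ k ∉ t := mem_sdiff
      rw [mem_powersetCard, subset_erase, mem_powersetCard]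
      tauto
  have hcard : ∀ k ∈ range n, uStat (r + 1) ((range n).erase k) φ =
      (∑ t ∈ ((range n).erase k).powersetCard (r + 1), φ t) / ((n - 1).choose (r + 1) : ℝ) := by
    intro k hk
    rw [uStat, card_erase_of_mem hk, card_range]
  simp only [jackknife]
  rw [← sum_div, sum_sub_distrib, ← mul_sum, ← mul_sum, sum_congr rfl hcard, ← sum_div, hdel]
  simp only [sum_const, card_range, nsmul_eq_mul, uStat]
  congr 1
  obtain ⟨N, rfl⟩ : ∃ N, n = N + r + 2 := ⟨n - (r + 2), by omega⟩
  rw [show N + r + 2 - 1 = N + r + 1 from rfl]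
  have e : ((N + r + 1).choose (r + 1) : ℝ) * ((N : ℝ) + r + 2) =
      ((N + r + 2).choose (r + 1) : ℝ) * ((N : ℝ) + 1) := by
    have := Nat.choose_mul_succ_eq (N + r + 1) (r + 1)
    rw [show N + r + 1 + 1 - (r + 1) = N + 1 by omega] at this
    exact_mod_cast this
  have p1 : ((N + r + 1).choose (r + 1) : ℝ) ≠ 0 := by
    exact_mod_cast (Nat.choose_pos (by omega)).ne'
  have p2 : ((N + r + 2).choose (r + 1) : ℝ) ≠ 0 := by
    exact_mod_cast (Nat.choose_pos (by omega)).ne'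
  push_cast
  set S := ∑ t ∈ (range (N + r + 2)).powersetCard (r + 1), φ t
  have key : ((N : ℝ) + r + 2 - 1) * (((N : ℝ) + r + 2 - (r + 1)) * S /
      ((N + r + 1).choose (r + 1) : ℝ)) =
      ((N : ℝ) + r + 2 - 1) * (((N : ℝ) + r + 2) * (S / ((N + r + 2).choose (r + 1) : ℝ))) := by
    congr 1
    rw [← mul_div_assoc, div_eq_div_iff p1 p2]
    linear_combination -S * e
  rw [key]
  ring

/-! ### Counting overlapping pairs of subsets. -/

/-- The pairs of `r`-element subsets that meet make up a fraction at most `r ^ 2 / N` of all. -/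
theorem card_pairs_inter_nonempty_le {r : ℕ} (hr : 1 ≤ r) {s : Finset ℕ} (hs : r ≤ s.card) :
    (((s.powersetCard r ×ˢ s.powersetCard r).filter fun p => (p.1 ∩ p.2).Nonempty).card : ℝ) ≤
      (s.card.choose r : ℝ) ^ 2 * ((r : ℝ) ^ 2 / s.card) := by
  obtain ⟨q, rfl⟩ : ∃ q, r = q + 1 := ⟨r - 1, by omega⟩
  -- Union bound: choose `t`, then an element of `t`, then a subset through that element.
  -- Overcounting costs only a constant.
  have hsub : ((s.powersetCard (q + 1) ×ˢ s.powersetCard (q + 1)).filter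
      fun p => (p.1 ∩ p.2).Nonempty) ⊆ (s.powersetCard (q + 1)).biUnion fun t =>
        t.biUnion fun i => {t} ×ˢ (s.powersetCard (q + 1)).filter (i ∈ ·) := by
    rintro ⟨t, u⟩ h
    simp only [mem_filter, mem_product] at h
    obtain ⟨i, hi⟩ := h.2
    simp only [mem_biUnion, mem_product, mem_singleton, mem_filter]
    exact ⟨t, h.1.1, i, (mem_inter.1 hi).1, rfl, h.1.2, (mem_inter.1 hi).2⟩
  have hcard : ((s.powersetCard (q + 1) ×ˢ s.powersetCard (q + 1)).filter
      fun p => (p.1 ∩ p.2).Nonempty).card ≤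
      s.card.choose (q + 1) * ((q + 1) * (s.card - 1).choose q) := by
    refine (card_le_card hsub).trans ?_
    refine (card_biUnion_le_card_mul _ _ ((q + 1) * (s.card - 1).choose q) fun t ht => ?_).trans
      (by rw [card_powersetCard])
    obtain ⟨ht1, ht2⟩ := mem_powersetCard.1 ht
    refine (card_biUnion_le_card_mul _ _ ((s.card - 1).choose q) fun i hi => ?_).trans
      (by rw [ht2])
    rw [card_product, card_singleton, one_mul, card_filter_mem_powersetCard (ht1 hi)]
  refine (Nat.cast_le.2 hcard).trans (le_of_eq ?_)
  obtain ⟨N, hN⟩ : ∃ N, s.card = N + 1 := ⟨s.card - 1, by omega⟩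
  rw [hN, Nat.add_sub_cancel]
  have e : ((N : ℝ) + 1) * (N.choose q : ℝ) = ((N + 1).choose (q + 1) : ℝ) * ((q : ℝ) + 1) := by
    exact_mod_cast Nat.add_one_mul_choose_eq N q
  have : (N : ℝ) + 1 ≠ 0 := by positivity
  push_cast
  rw [← mul_div_assoc, eq_div_iff this]
  linear_combination ((N + 1).choose (q + 1) : ℝ) * ((q : ℝ) + 1) * e

/-- The pairs of `(r + 1)`-element subsets with at least two common elements make up a fraction
at most `(r (r + 1)) ^ 2 / (N (N - 1))` of all. -/
theorem card_pairs_one_lt_card_inter_le {r : ℕ} (hr : 1 ≤ r) {s : Finset ℕ}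
    (hs : r + 1 ≤ s.card) :
    (((s.powersetCard (r + 1) ×ˢ s.powersetCard (r + 1)).filter
      fun p => 1 < (p.1 ∩ p.2).card).card : ℝ) ≤
      (s.card.choose (r + 1) : ℝ) ^ 2 *
        (((r : ℝ) * (r + 1)) ^ 2 / (s.card * ((s.card : ℝ) - 1))) := by
  obtain ⟨q, rfl⟩ : ∃ q, r = q + 1 := ⟨r - 1, by omega⟩
  -- The same union bound with an ordered pair of distinct elements of `t`.
  have hsub : ((s.powersetCard (q + 2) ×ˢ s.powersetCard (q + 2)).filter
      fun p => 1 < (p.1 ∩ p.2).card) ⊆ (s.powersetCard (q + 2)).biUnion fun t =>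
        t.offDiag.biUnion fun i =>
          {t} ×ˢ (s.powersetCard (q + 2)).filter fun u => i.1 ∈ u ∧ i.2 ∈ u := by
    rintro ⟨t, u⟩ h
    simp only [mem_filter, mem_product] at h
    obtain ⟨i, hi, j, hj, hij⟩ := one_lt_card.1 h.2
    simp only [mem_biUnion, mem_product, mem_singleton, mem_filter, mem_offDiag]
    exact ⟨t, h.1.1, (i, j), ⟨(mem_inter.1 hi).1, (mem_inter.1 hj).1, hij⟩, rfl, h.1.2,
      (mem_inter.1 hi).2, (mem_inter.1 hj).2⟩
  have hcard : ((s.powersetCard (q + 2) ×ˢ s.powersetCard (q + 2)).filter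
      fun p => 1 < (p.1 ∩ p.2).card).card ≤
      s.card.choose (q + 2) * ((q + 2) * (q + 1) * (s.card - 2).choose q) := by
    refine (card_le_card hsub).trans ?_
    refine (card_biUnion_le_card_mul _ _ ((q + 2) * (q + 1) * (s.card - 2).choose q)
      fun t ht => ?_).trans (by rw [card_powersetCard])
    obtain ⟨ht1, ht2⟩ := mem_powersetCard.1 ht
    refine (card_biUnion_le_card_mul _ _ ((s.card - 2).choose q) fun i hi => ?_).trans
      (le_of_eq ?_)
    · obtain ⟨h1, h2, h3⟩ := mem_offDiag.1 hi
      rw [card_product, card_singleton, one_mul,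
        card_filter_mem_mem_powersetCard (ht1 h1) (ht1 h2) h3]
    · rw [offDiag_card, ht2]
      congr 1
      rw [← Nat.mul_sub_one]
      rfl
  refine (Nat.cast_le.2 hcard).trans (le_of_eq ?_)
  obtain ⟨N, hN⟩ : ∃ N, s.card = N + 2 := ⟨s.card - 2, by omega⟩
  rw [hN, Nat.add_sub_cancel]
  have e1 : ((N : ℝ) + 1) * (N.choose q : ℝ) = ((N + 1).choose (q + 1) : ℝ) * ((q : ℝ) + 1) := by
    exact_mod_cast Nat.add_one_mul_choose_eq N q
  have e2 : ((N : ℝ) + 2) * ((N + 1).choose (q + 1) : ℝ) =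
      ((N + 2).choose (q + 2) : ℝ) * ((q : ℝ) + 2) := by
    exact_mod_cast Nat.add_one_mul_choose_eq (N + 1) (q + 1)
  have h : ((N : ℝ) + 2) * (N + 2 - 1) ≠ 0 := by
    rw [show (N : ℝ) + 2 - 1 = N + 1 by ring]; positivity
  push_cast
  rw [← mul_div_assoc, eq_div_iff h]
  linear_combination ((N + 2).choose (q + 2) : ℝ) * ((q : ℝ) + 2) * ((q : ℝ) + 1) *
    (((N : ℝ) + 2) * e1 + ((q : ℝ) + 1) * e2)

/-! ### The maximum kernel and its projection under the product law. -/

theorem sampleMax_of_nonempty {ι : Type*} {s : Finset ι} (hs : s.Nonempty) (x : ι → ℝ) :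
    sampleMax s x = s.sup' hs x := by
  simp [sampleMax, hs]

theorem measurable_sampleMax {ι : Type*} (s : Finset ι) :
    Measurable (fun x : ι → ℝ => sampleMax s x) := by
  by_cases hs : s.Nonempty
  · simp only [sampleMax_of_nonempty hs]
    have := Finset.measurable_sup' hs (f := fun i (x : ι → ℝ) => x i)
      fun i _ => measurable_pi_apply i
    convert this using 1
    ext x
    simp [Finset.sup'_apply]
  · simp [sampleMax, hs]

theorem measurable_pwmKernel (r : ℕ) : Measurable (pwmKernel r) := measurable_sampleMax _

theorem le_pwmKernel {r : ℕ} (x : Fin (r + 1) → ℝ) (i : Fin (r + 1)) : x i ≤ pwmKernel r x := by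
  rw [pwmKernel, sampleMax_of_nonempty univ_nonempty]
  exact Finset.le_sup' x (mem_univ i)

theorem exists_pwmKernel_eq {r : ℕ} (x : Fin (r + 1) → ℝ) : ∃ i, pwmKernel r x = x i := by
  rw [pwmKernel, sampleMax_of_nonempty univ_nonempty]
  obtain ⟨i, -, hi⟩ := Finset.exists_mem_eq_sup' (univ_nonempty (α := Fin (r + 1))) x
  exact ⟨i, hi⟩

theorem pwmKernel_eq_of_forall_le {r : ℕ} {x : Fin (r + 1) → ℝ} {i : Fin (r + 1)}
    (h : ∀ j, x j ≤ x i) : pwmKernel r x = x i := by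
  obtain ⟨j, hj⟩ := exists_pwmKernel_eq x
  exact le_antisymm (hj ▸ h j) (le_pwmKernel x i)

section Law

variable {ν : Measure ℝ} [IsProbabilityMeasure ν] {r : ℕ}

theorem nullSingletonClass_of_continuous_cdf (hcont : Continuous (cdf ν)) : NullSingletonClass ν := by
  refine ⟨fun a => ?_⟩
  rw [← measure_cdf ν, StieltjesFunction.measure_singleton,
    (hcont.continuousAt.continuousWithinAt).leftLim_eq]
  simp

theorem measurePreserving_insertNth (ν : Measure ℝ) [IsProbabilityMeasure ν] (i : Fin (r + 1)) :
    MeasurePreserving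
      (fun p : ℝ × (Fin r → ℝ) => (i.insertNth p.1 p.2 : Fin (r + 1) → ℝ))
      (ν.prod (Measure.pi fun _ => ν)) (Measure.pi fun _ => ν) :=
  (measurePreserving_piFinSuccAbove (fun _ : Fin (r + 1) => ν) i).symm

theorem measurePreserving_cons (ν : Measure ℝ) [IsProbabilityMeasure ν] :
    MeasurePreserving (fun p : ℝ × (Fin r → ℝ) => (Fin.cons p.1 p.2 : Fin (r + 1) → ℝ))
      (ν.prod (Measure.pi fun _ => ν)) (Measure.pi fun _ => ν) := by
  simpa only [Fin.insertNth_zero'] using measurePreserving_insertNth (r := r) ν 0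

theorem ae_injective [NullSingletonClass ν] :
    ∀ᵐ x ∂(Measure.pi fun _ : Fin (r + 1) => ν), ∀ i j, i ≠ j → x i ≠ x j := by
  rw [ae_all_iff]
  intro i
  rw [ae_all_iff]
  intro j
  rcases eq_or_ne i j with rfl | hij
  · simp
  obtain ⟨k, rfl⟩ := Fin.exists_succAbove_eq hij.symm
  rw [← (measurePreserving_insertNth (r := r) ν i).map_eq,
    ae_map_iff (measurePreserving_insertNth (r := r) ν i).measurable.aemeasurable
      (show MeasurableSet _ by
        have : {x : Fin (r + 1) → ℝ | i ≠ i.succAbove k → x i ≠ x (i.succAbove k)} =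
            {x | x i = x (i.succAbove k)}ᶜ := by
          ext x; simp [hij]
        rw [this]
        exact (measurableSet_eq_fun (measurable_pi_apply (X := fun _ => ℝ) _)
          (measurable_pi_apply (X := fun _ => ℝ) _)).compl)]
  simp only [Fin.insertNth_apply_same, Fin.insertNth_apply_succAbove]
  have hmeas : MeasurableSet {p : ℝ × (Fin r → ℝ) | p.1 = p.2 k} :=
    measurableSet_eq_fun measurable_fst ((measurable_pi_apply k).comp measurable_snd)
  have h0 : (ν.prod (Measure.pi fun _ : Fin r => ν)) {p | p.1 = p.2 k} = 0 := by
    rw [Measure.measure_prod_null hmeas]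
    refine Eventually.of_forall fun a => ?_
    have h := Measure.pi_hyperplane (fun _ : Fin r => ν) k a
    have hset : (Prod.mk a ⁻¹' {p : ℝ × (Fin r → ℝ) | p.1 = p.2 k}) = {f | f k = a} := by
      ext f
      simp [eq_comm]
    simpa only [hset, Pi.zero_apply] using h
  filter_upwards [measure_eq_zero_iff_ae_notMem.1 h0] with p hp _
  exact hp

/-- Almost surely there are no ties, so exactly one coordinate attains the maximum. By Fubini the
event that coordinate `i` does contributes `∫ a F(a) ^ r`, the same for each of the `r + 1`
coordinates. -/
theorem integral_pwmKernel [NullSingletonClass ν]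
    (hint : Integrable (pwmKernel r) (Measure.pi fun _ : Fin (r + 1) => ν)) :
    ∫ x, pwmKernel r x ∂(Measure.pi fun _ : Fin (r + 1) => ν) = ((r : ℝ) + 1) * pwm ν r := by
  let A : Fin (r + 1) → Set (Fin (r + 1) → ℝ) := fun i => {x | ∀ j, x j ≤ x i}
  have hA : ∀ i, MeasurableSet (A i) := by
    intro i
    simp only [A, Set.ofPred_forall]
    exact MeasurableSet.iInter fun j =>
      measurableSet_le (measurable_pi_apply j) (measurable_pi_apply i)
  have hkey : ∀ i, Set.indicator (A i) (fun x => x i) = Set.indicator (A i) (pwmKernel r) := by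
    intro i
    refine Set.indicator_congr fun x hx => (pwmKernel_eq_of_forall_le hx).symm
  have hintA : ∀ i, Integrable (Set.indicator (A i) (fun x => x i))
      (Measure.pi fun _ : Fin (r + 1) => ν) := fun i => by
    rw [hkey i]; exact hint.indicator (hA i)
  have hsum : ∀ᵐ x ∂(Measure.pi fun _ : Fin (r + 1) => ν),
      pwmKernel r x = ∑ i, Set.indicator (A i) (fun x => x i) x := by
    filter_upwards [ae_injective (ν := ν) (r := r)] with x hx
    obtain ⟨i, hi⟩ := exists_pwmKernel_eq x
    rw [Finset.sum_eq_single i]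
    · rw [Set.indicator_of_mem, hi]
      intro j
      rw [← hi]
      exact le_pwmKernel x j
    · intro j _ hj
      refine Set.indicator_of_notMem (fun hmem => ?_) _
      refine hx j i hj (le_antisymm ?_ (hmem i))
      rw [← hi]
      exact le_pwmKernel x j
    · simp
  have hone : ∀ i, ∫ x, Set.indicator (A i) (fun x => x i) x
      ∂(Measure.pi fun _ : Fin (r + 1) => ν) = pwm ν r := by
    intro i
    have hmp := measurePreserving_insertNth (r := r) ν i
    have hI := hmp.integrable_comp_of_integrable (hintA i)
    rw [← hmp.map_eq, integral_map hmp.measurable.aemeasurable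
      (by rw [hmp.map_eq]; exact (hintA i).aestronglyMeasurable)]
    refine (integral_prod _ hI).trans ?_
    rw [pwm]
    refine integral_congr_ae (Eventually.of_forall fun a => ?_)
    have : ∀ y : Fin r → ℝ, Set.indicator (A i) (fun x => x i) (i.insertNth a y) =
        Set.indicator (Set.univ.pi fun _ => Set.Iic a) (fun _ => a) y := by
      intro y
      have hiff : (i.insertNth a y : Fin (r + 1) → ℝ) ∈ A i ↔
          y ∈ Set.univ.pi fun _ : Fin r => Set.Iic a := by
        simp [A, Fin.forall_iff_succAbove i, Pi.le_def]
      by_cases hy : y ∈ Set.univ.pi fun _ : Fin r => Set.Iic a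
      · rw [Set.indicator_of_mem hy, Set.indicator_of_mem (hiff.2 hy)]
        simp
      · rw [Set.indicator_of_notMem hy, Set.indicator_of_notMem (mt hiff.1 hy)]
    simp only [Function.comp_apply, this]
    rw [integral_indicator_const _ (MeasurableSet.univ_pi fun _ => measurableSet_Iic),
      measureReal_def, Measure.pi_pi]
    simp [cdf_eq_real, measureReal_def, mul_comm]
  rw [integral_congr_ae hsum, integral_finsetSum _ fun i _ => hintA i,
    Finset.sum_congr rfl fun i _ => hone i]
  simp

/-- The centred first projection `E (h (X_1, …, X_{r+1}) | X_1 = x) - E h (X_1, …, X_{r+1})`. -/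
noncomputable def centredProjection (ν : Measure ℝ) (r : ℕ) (x : ℝ) : ℝ :=
  (∫ y : Fin r → ℝ, pwmKernel r (Fin.cons x y) ∂(Measure.pi fun _ => ν)) -
    ((r : ℝ) + 1) * pwm ν r

theorem measurable_cons : Measurable
    (fun p : ℝ × (Fin r → ℝ) => (Fin.cons p.1 p.2 : Fin (r + 1) → ℝ)) :=
  (measurePreserving_cons (r := r) (Measure.dirac 0)).measurable

theorem measurable_integral_pwmKernel_cons : Measurable fun x : ℝ =>
    ∫ y : Fin r → ℝ, pwmKernel r (Fin.cons x y) ∂(Measure.pi fun _ => ν) :=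
  (StronglyMeasurable.integral_prod_right
    (f := fun (x : ℝ) (y : Fin r → ℝ) => pwmKernel r (Fin.cons x y))
    ((measurable_pwmKernel r).comp measurable_cons).stronglyMeasurable).measurable

theorem measurable_centredProjection : Measurable (centredProjection ν r) :=
  measurable_integral_pwmKernel_cons.sub_const _

theorem sq_integral_le {α : Type*} [MeasurableSpace α] {μ : Measure α} [IsProbabilityMeasure μ]
    {f : α → ℝ} (hf : MemLp f 2 μ) : (∫ x, f x ∂μ) ^ 2 ≤ ∫ x, f x ^ 2 ∂μ := by
  have h := variance_nonneg f μ
  rw [variance_eq_sub hf] at h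
  simpa using h

/-- Integrating out variables contracts `L²`: Jensen on almost every section, then Fubini. -/
theorem memLp_integral_pwmKernel_cons
    (hmom : MemLp (pwmKernel r) 2 (Measure.pi fun _ : Fin (r + 1) => ν)) :
    MemLp (fun x : ℝ => ∫ y : Fin r → ℝ, pwmKernel r (Fin.cons x y) ∂(Measure.pi fun _ => ν))
      2 ν := by
  have hmp := measurePreserving_cons (r := r) ν
  have hmeas := (measurable_pwmKernel r).comp (measurable_cons (r := r))
  have hI := (memLp_two_iff_integrable_sq hmeas.aestronglyMeasurable).1
    (hmom.comp_measurePreserving hmp)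
  rw [memLp_two_iff_integrable_sq measurable_integral_pwmKernel_cons.aestronglyMeasurable]
  refine hI.integral_prod_left.mono'
    (measurable_integral_pwmKernel_cons.pow_const 2).aestronglyMeasurable ?_
  filter_upwards [hI.prod_right_ae] with x hx
  rw [Real.norm_of_nonneg (sq_nonneg _)]
  exact sq_integral_le ((memLp_two_iff_integrable_sq
    (hmeas.comp measurable_prodMk_left).aestronglyMeasurable).2 hx)

theorem memLp_centredProjection
    (hmom : MemLp (pwmKernel r) 2 (Measure.pi fun _ : Fin (r + 1) => ν)) :
    MemLp (centredProjection ν r) 2 ν :=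
  (memLp_integral_pwmKernel_cons hmom).sub (memLp_const _)

theorem integral_centredProjection [NullSingletonClass ν]
    (hmom : MemLp (pwmKernel r) 2 (Measure.pi fun _ : Fin (r + 1) => ν)) :
    ∫ x, centredProjection ν r x ∂ν = 0 := by
  have hint := hmom.integrable one_le_two
  have hmp := measurePreserving_cons (r := r) ν
  have h1 : ∫ x, ∫ y : Fin r → ℝ, pwmKernel r (Fin.cons x y) ∂(Measure.pi fun _ => ν) ∂ν =
      ((r : ℝ) + 1) * pwm ν r := by
    rw [← integral_pwmKernel hint]
    conv_rhs => rw [← hmp.map_eq, integral_map hmp.measurable.aemeasurable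
      (measurable_pwmKernel r).aestronglyMeasurable]
    exact (integral_prod _ (hmp.integrable_comp_of_integrable hint)).symm
  simp only [centredProjection]
  rw [integral_sub ((memLp_integral_pwmKernel_cons hmom).integrable one_le_two)
    (integrable_const _), h1]
  simp

/-- `pwmProjection` subtracts `β` rather than the mean `(r + 1) β`, so it differs from the centred
version by the constant `r β`, which the variance ignores. -/
theorem integral_centredProjection_sq [NullSingletonClass ν]
    (hmom : MemLp (pwmKernel r) 2 (Measure.pi fun _ : Fin (r + 1) => ν)) :
    ∫ x, centredProjection ν r x ^ 2 ∂ν = variance (pwmProjection ν r) ν := by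
  have hm : AEMeasurable (centredProjection ν r) ν := measurable_centredProjection.aemeasurable
  have h1 : pwmProjection ν r = fun x => centredProjection ν r x + (r : ℝ) * pwm ν r := by
    ext x
    simp only [pwmProjection, centredProjection]
    ring
  rw [h1, variance_add_const hm.aestronglyMeasurable, variance_of_integral_eq_zero hm
    (integral_centredProjection hmom)]

end Law

/-! ### The degenerate remainder of the Hoeffding decomposition. -/

/-- The part of the kernel that is orthogonal to the functions of one variable. -/
noncomputable def kernelRemainder (ν : Measure ℝ) (r : ℕ) (z : Fin (r + 1) → ℝ) : ℝ :=
  pwmKernel r z - (((r : ℝ) + 1) * pwm ν r + ∑ j, centredProjection ν r (z j))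

/-- `kernelRemainder` at the observations `x i`, `i ∈ t`. -/
noncomputable def sampleRemainder (ν : Measure ℝ) (r : ℕ) (x : ℕ → ℝ) (t : Finset ℕ) : ℝ :=
  sampleMax t x - (((r : ℝ) + 1) * pwm ν r + ∑ j ∈ t, centredProjection ν r (x j))

theorem sampleMax_congr {ι : Type*} {s : Finset ι} {x y : ι → ℝ} (h : ∀ i ∈ s, x i = y i) :
    sampleMax s x = sampleMax s y := by
  by_cases hs : s.Nonempty
  · rw [sampleMax_of_nonempty hs, sampleMax_of_nonempty hs]
    exact Finset.sup'_congr hs rfl h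
  · simp [sampleMax, hs]

theorem sampleRemainder_congr {ν : Measure ℝ} {r : ℕ} {x y : ℕ → ℝ} {t : Finset ℕ}
    (h : ∀ i ∈ t, x i = y i) : sampleRemainder ν r x t = sampleRemainder ν r y t := by
  rw [sampleRemainder, sampleRemainder, sampleMax_congr h, sum_congr rfl fun i hi => by rw [h i hi]]

theorem sampleMax_map {ι κ : Type*} [DecidableEq ι] (s : Finset κ) (e : κ → ι) (x : ι → ℝ) :
    sampleMax (s.image e) x = sampleMax s (x ∘ e) := by
  by_cases hs : s.Nonempty
  · rw [sampleMax_of_nonempty hs, sampleMax_of_nonempty (hs.image e), Finset.sup'_image]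
  · rw [not_nonempty_iff_eq_empty] at hs
    simp [sampleMax, hs]

theorem sampleRemainder_image {ν : Measure ℝ} {r : ℕ} (x : ℕ → ℝ) {e : Fin (r + 1) → ℕ}
    (he : Function.Injective e) :
    sampleRemainder ν r x (univ.image e) = kernelRemainder ν r (x ∘ e) := by
  rw [sampleRemainder, kernelRemainder, sampleMax_map, sum_image fun a _ b _ h => he h]
  rfl

theorem exists_injective_image_eq {t : Finset ℕ} {m : ℕ} (ht : t.card = m) :
    ∃ e : Fin m → ℕ, Function.Injective e ∧ univ.image e = t := by
  refine ⟨t.orderEmbOfFin ht, (t.orderEmbOfFin ht).injective, ?_⟩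
  rw [← coe_inj]
  simp

section Law

variable {ν : Measure ℝ} [IsProbabilityMeasure ν] {r : ℕ}

theorem measurable_kernelRemainder : Measurable (kernelRemainder ν r) := by
  have := measurable_pwmKernel r
  have := measurable_centredProjection (ν := ν) (r := r)
  unfold kernelRemainder
  fun_prop

theorem measurable_sampleRemainder (t : Finset ℕ) :
    Measurable fun x => sampleRemainder ν r x t := by
  have := measurable_sampleMax t
  have := measurable_centredProjection (ν := ν) (r := r)
  unfold sampleRemainder
  fun_prop

theorem memLp_kernelRemainder
    (hmom : MemLp (pwmKernel r) 2 (Measure.pi fun _ : Fin (r + 1) => ν)) :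
    MemLp (kernelRemainder ν r) 2 (Measure.pi fun _ : Fin (r + 1) => ν) := by
  have h : ∀ j : Fin (r + 1), MemLp (fun z : Fin (r + 1) → ℝ => centredProjection ν r (z j)) 2
      (Measure.pi fun _ => ν) := fun j =>
    (memLp_centredProjection hmom).comp_measurePreserving
      (measurePreserving_eval (fun _ : Fin (r + 1) => ν) j)
  have hs := memLp_finsetSum univ fun j (_ : j ∈ univ) => h j
  have hc : MemLp (fun _ : Fin (r + 1) → ℝ => ((r : ℝ) + 1) * pwm ν r) 2
      (Measure.pi fun _ => ν) := memLp_const _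
  exact hmom.sub (hc.add hs)

/-- The projection was chosen to make this cancel: the other one-variable terms have mean zero, and
the constant and the term in `a` remove the conditional mean of the kernel. -/
theorem integral_kernelRemainder_cons [NullSingletonClass ν]
    (hmom : MemLp (pwmKernel r) 2 (Measure.pi fun _ : Fin (r + 1) => ν)) (a : ℝ) :
    ∫ y : Fin r → ℝ, kernelRemainder ν r (Fin.cons a y) ∂(Measure.pi fun _ => ν) = 0 := by
  -- Sections are integrable only for almost every `a`; on the others the integral is `0` by
  -- convention, so the identity holds everywhere.
  by_cases hI : Integrable (fun y : Fin r → ℝ => kernelRemainder ν r (Fin.cons a y))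
      (Measure.pi fun _ => ν)
  swap
  · exact integral_undef hI
  have hg : ∀ j : Fin r, Integrable (fun y : Fin r → ℝ => centredProjection ν r (y j))
      (Measure.pi fun _ => ν) := fun j =>
    integrable_comp_eval (μ := fun _ : Fin r => ν)
      ((memLp_centredProjection hmom).integrable one_le_two)
  have hg0 : ∀ j : Fin r, ∫ y : Fin r → ℝ, centredProjection ν r (y j) ∂(Measure.pi fun _ => ν)
      = 0 := fun j => by
    rw [integral_comp_eval (μ := fun _ : Fin r => ν)
      measurable_centredProjection.aestronglyMeasurable]
    exact integral_centredProjection hmom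
  have hsum := integrable_finsetSum univ fun j (_ : j ∈ univ) => hg j
  have hrest : Integrable (fun y : Fin r → ℝ => ((r : ℝ) + 1) * pwm ν r +
      (centredProjection ν r a + ∑ j, centredProjection ν r (y j))) (Measure.pi fun _ => ν) :=
    (integrable_const _).add ((integrable_const _).add hsum)
  have heq : ∀ y : Fin r → ℝ, kernelRemainder ν r (Fin.cons a y) =
      pwmKernel r (Fin.cons a y) - (((r : ℝ) + 1) * pwm ν r +
      (centredProjection ν r a + ∑ j, centredProjection ν r (y j))) := by
    intro y
    simp [kernelRemainder, Fin.sum_univ_succ]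
  have hK : Integrable (fun y : Fin r → ℝ => pwmKernel r (Fin.cons a y))
      (Measure.pi fun _ => ν) := by
    refine (hI.add hrest).congr (Eventually.of_forall fun y => ?_)
    simp [heq]
  simp only [heq]
  have hg1 : Integrable (fun y : Fin r → ℝ => centredProjection ν r a +
      ∑ j, centredProjection ν r (y j)) (Measure.pi fun _ => ν) := (integrable_const _).add hsum
  rw [integral_sub hK hrest, integral_add (integrable_const _) hg1,
    integral_add (integrable_const _) hsum, integral_finsetSum _ fun j _ => hg j]
  simp only [hg0]
  simp [centredProjection]

end Law

/-! ### Orthogonality of remainders over the sample. -/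

section Sample

variable {Ω : Type*} [MeasurableSpace Ω] {P : Measure Ω} [IsProbabilityMeasure P]
  {X : ℕ → Ω → ℝ} {ν : Measure ℝ} {r : ℕ}

theorem measurePreserving_sample (hX : ∀ i, Measurable (X i)) (hindep : iIndepFun X P)
    (hlaw : ∀ i, P.map (X i) = ν) {m : ℕ} {e : Fin m → ℕ} (he : Function.Injective e) :
    MeasurePreserving (fun ω j => X (e j) ω) P (Measure.pi fun _ : Fin m => ν) := by
  refine ⟨measurable_pi_lambda _ fun j => hX (e j), ?_⟩
  have h := (iIndepFun_iff_map_fun_eq_pi_map fun j => (hX (e j)).aemeasurable).1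
    (hindep.precomp he)
  rw [h]
  simp only [hlaw]

variable [IsProbabilityMeasure ν]

theorem memLp_sampleRemainder (hX : ∀ i, Measurable (X i)) (hindep : iIndepFun X P)
    (hlaw : ∀ i, P.map (X i) = ν)
    (hmom : MemLp (pwmKernel r) 2 (Measure.pi fun _ : Fin (r + 1) => ν))
    {t : Finset ℕ} (ht : t.card = r + 1) :
    MemLp (fun ω => sampleRemainder ν r (fun i => X i ω) t) 2 P := by
  obtain ⟨e, he, rfl⟩ := exists_injective_image_eq ht
  simp only [sampleRemainder_image _ he]
  exact (memLp_kernelRemainder hmom).comp_measurePreserving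
    (measurePreserving_sample hX hindep hlaw he)

theorem integral_sampleRemainder_sq (hX : ∀ i, Measurable (X i)) (hindep : iIndepFun X P)
    (hlaw : ∀ i, P.map (X i) = ν) {t : Finset ℕ} (ht : t.card = r + 1) :
    ∫ ω, sampleRemainder ν r (fun i => X i ω) t ^ 2 ∂P =
      ∫ z, kernelRemainder ν r z ^ 2 ∂(Measure.pi fun _ : Fin (r + 1) => ν) := by
  obtain ⟨e, he, rfl⟩ := exists_injective_image_eq ht
  simp only [sampleRemainder_image _ he]
  have hmp := measurePreserving_sample hX hindep hlaw he
  rw [← hmp.map_eq, integral_map hmp.measurable.aemeasurable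
    (measurable_kernelRemainder.pow_const 2).aestronglyMeasurable]
  rfl

/-- Choose `i ∈ t` containing any overlap with `s`. The other `r` variables of `t` are independent
of those indexed by `insert i s`, and integrating them out first kills the remainder at `t`. -/
theorem integral_sampleRemainder_mul_eq_zero [NullSingletonClass ν]
    (hX : ∀ i, Measurable (X i)) (hindep : iIndepFun X P) (hlaw : ∀ i, P.map (X i) = ν)
    (hmom : MemLp (pwmKernel r) 2 (Measure.pi fun _ : Fin (r + 1) => ν))
    {t s : Finset ℕ} (ht : t.card = r + 1) (hs : s.card = r + 1) (hts : (t ∩ s).card ≤ 1) :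
    ∫ ω, sampleRemainder ν r (fun i => X i ω) t * sampleRemainder ν r (fun i => X i ω) s ∂P
      = 0 := by
  obtain ⟨i, hi, hsub⟩ : ∃ i ∈ t, t ∩ s ⊆ {i} := by
    rcases (t ∩ s).eq_empty_or_nonempty with h | ⟨i, hi⟩
    · obtain ⟨i, hi⟩ := card_pos.1 (by omega : 0 < t.card)
      exact ⟨i, hi, by simp [h]⟩
    · exact ⟨i, (mem_inter.1 hi).1, fun j hj =>
        mem_singleton.2 (card_le_one.1 hts j hj i hi)⟩
  have hcard : (t.erase i).card = r := by rw [card_erase_of_mem hi, ht]; rfl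
  obtain ⟨e, he, heq⟩ := exists_injective_image_eq hcard
  have hmem : ∀ j, e j ∈ t.erase i := fun j => heq ▸ mem_image_of_mem e (mem_univ j)
  have hdisj : Disjoint (insert i s) (t.erase i) := by
    rw [disjoint_left]
    intro j hj hj'
    obtain ⟨h1, h2⟩ := mem_erase.1 hj'
    rcases mem_insert.1 hj with h | h
    · exact h1 h
    · exact h1 (mem_singleton.1 (hsub (mem_inter.2 ⟨h2, h⟩)))
  -- `W` carries the observations indexed by `insert i s`, padded with zeros so that
  -- `sampleRemainder` still applies; `U` carries the rest of `t`.
  let W : Ω → ℕ → ℝ := fun ω n => if n ∈ insert i s then X n ω else 0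
  let U : Ω → Fin r → ℝ := fun ω j => X (e j) ω
  have hWm : Measurable W := measurable_pi_lambda _ fun n => by
    by_cases h : n ∈ insert i s
    · simpa only [W, h, if_true] using hX n
    · simpa only [W, h, if_false] using measurable_const
  have hU := measurePreserving_sample hX hindep hlaw he
  have hWU : IndepFun W U P := by
    have h := hindep.indepFun_finset _ _ hdisj hX
    refine h.comp (φ := fun w n => if hn : n ∈ insert i s then w ⟨n, hn⟩ else 0)
      (ψ := fun u j => u ⟨e j, hmem j⟩) ?_ ?_
    · refine measurable_pi_lambda _ fun n => ?_
      by_cases hn : n ∈ insert i s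
      · simpa only [hn, dite_true] using measurable_pi_apply _
      · simpa only [hn, dite_false] using measurable_const
    · exact measurable_pi_lambda _ fun j => measurable_pi_apply _
  have hmap : P.map (fun ω => (W ω, U ω)) = (P.map W).prod (Measure.pi fun _ => ν) := by
    rw [(indepFun_iff_map_prod_eq_prod_map_map hWm.aemeasurable hU.measurable.aemeasurable).1 hWU,
      ← hU.map_eq]
  have h1 : ∀ ω, sampleRemainder ν r (fun i => X i ω) t =
      kernelRemainder ν r (Fin.cons (W ω i) (U ω)) := by
    intro ω
    have hinj : Function.Injective (Fin.cons i e : Fin (r + 1) → ℕ) :=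
      Fin.cons_injective_iff.2 ⟨fun ⟨j, hj⟩ => (mem_erase.1 (hmem j)).1 hj, he⟩
    have himage : univ.image (Fin.cons i e : Fin (r + 1) → ℕ) = t := by
      rw [← insert_erase hi, ← heq, ← coe_inj]
      simp [Fin.range_cons]
    conv_lhs => rw [← himage, sampleRemainder_image _ hinj]
    congr 1
    ext j
    refine Fin.cases ?_ (fun j => ?_) j
    · simp [W]
    · simp [U]
  have h2 : ∀ ω, sampleRemainder ν r (fun i => X i ω) s = sampleRemainder ν r (W ω) s := by
    intro ω
    refine sampleRemainder_congr fun j hj => ?_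
    simp [W, hj]
  let f : (ℕ → ℝ) × (Fin r → ℝ) → ℝ := fun p =>
    kernelRemainder ν r (Fin.cons (p.1 i) p.2) * sampleRemainder ν r p.1 s
  have hf : Measurable f := by
    refine Measurable.mul ?_ ((measurable_sampleRemainder s).comp measurable_fst)
    have h : Measurable fun p : (ℕ → ℝ) × (Fin r → ℝ) => (p.1 i, p.2) :=
      ((measurable_pi_apply i).comp measurable_fst).prodMk measurable_snd
    exact measurable_kernelRemainder.comp (measurable_cons.comp h)
  have hint : Integrable (fun ω => f (W ω, U ω)) P := by
    have h := (memLp_sampleRemainder hX hindep hlaw hmom ht).integrable_mul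
      (memLp_sampleRemainder hX hindep hlaw hmom hs)
    refine h.congr (Eventually.of_forall fun ω => ?_)
    simp only [Pi.mul_apply, f, ← h1, ← h2]
  have hpair : Measurable fun ω => (W ω, U ω) := hWm.prodMk hU.measurable
  have hint' : Integrable f ((P.map W).prod (Measure.pi fun _ => ν)) := by
    rw [← hmap]
    exact (integrable_map_measure hf.aestronglyMeasurable hpair.aemeasurable).2 hint
  have : IsProbabilityMeasure (P.map W) := Measure.isProbabilityMeasure_map hWm.aemeasurable
  calc _ = ∫ ω, f (W ω, U ω) ∂P := by simp only [h1, h2, f]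
    _ = ∫ p, f p ∂((P.map W).prod (Measure.pi fun _ => ν)) := by
      rw [← hmap, integral_map hpair.aemeasurable hf.aestronglyMeasurable]
    _ = 0 := by
      rw [integral_prod _ hint']
      simp [f, integral_mul_const, integral_kernelRemainder_cons hmom]

/-- The second moment of a sum of remainders is at most a constant times the number of pairs of
index sets with at least two common elements. -/
theorem integral_sum_sampleRemainder_sq_le [NullSingletonClass ν]
    (hX : ∀ i, Measurable (X i)) (hindep : iIndepFun X P) (hlaw : ∀ i, P.map (X i) = ν)
    (hmom : MemLp (pwmKernel r) 2 (Measure.pi fun _ : Fin (r + 1) => ν))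
    {ι : Type*} (J : Finset ι) (τ : ι → Finset ℕ) (hτ : ∀ j ∈ J, (τ j).card = r + 1) :
    ∫ ω, (∑ j ∈ J, sampleRemainder ν r (fun i => X i ω) (τ j)) ^ 2 ∂P ≤
      (∫ z, kernelRemainder ν r z ^ 2 ∂(Measure.pi fun _ : Fin (r + 1) => ν)) *
        (((J ×ˢ J).filter fun p => 1 < (τ p.1 ∩ τ p.2).card).card : ℝ) := by
  set C := ∫ z, kernelRemainder ν r z ^ 2 ∂(Measure.pi fun _ : Fin (r + 1) => ν) with hC
  have hL := fun j (hj : j ∈ J) => memLp_sampleRemainder hX hindep hlaw hmom (hτ j hj)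
  have hmul : ∀ p ∈ J ×ˢ J, Integrable (fun ω => sampleRemainder ν r (fun i => X i ω) (τ p.1) *
      sampleRemainder ν r (fun i => X i ω) (τ p.2)) P := fun p hp =>
    (hL _ (mem_product.1 hp).1).integrable_mul (hL _ (mem_product.1 hp).2)
  simp only [pow_two, sum_mul_sum, ← sum_product']
  rw [integral_finsetSum _ hmul, card_filter, Nat.cast_sum, mul_sum]
  refine sum_le_sum fun p hp => ?_
  obtain ⟨hp1, hp2⟩ := mem_product.1 hp
  by_cases h : 1 < (τ p.1 ∩ τ p.2).card
  · rw [if_pos h, Nat.cast_one, mul_one]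
    have i1 := (hL _ hp1).integrable_sq
    have i2 := (hL _ hp2).integrable_sq
    have hle : ∫ ω, sampleRemainder ν r (fun i => X i ω) (τ p.1) *
        sampleRemainder ν r (fun i => X i ω) (τ p.2) ∂P ≤
        ∫ ω, (1 / 2) * (sampleRemainder ν r (fun i => X i ω) (τ p.1) ^ 2 +
          sampleRemainder ν r (fun i => X i ω) (τ p.2) ^ 2) ∂P := by
      refine integral_mono (hmul p hp) ((i1.add i2).const_mul _) fun ω => ?_
      have := sq_nonneg (sampleRemainder ν r (fun i => X i ω) (τ p.1) -
        sampleRemainder ν r (fun i => X i ω) (τ p.2))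
      simp only
      linarith
    rw [integral_const_mul, integral_add i1 i2,
      integral_sampleRemainder_sq hX hindep hlaw (hτ _ hp1),
      integral_sampleRemainder_sq hX hindep hlaw (hτ _ hp2), ← hC] at hle
    linarith
  · rw [if_neg h, integral_sampleRemainder_mul_eq_zero hX hindep hlaw hmom (hτ _ hp1)
      (hτ _ hp2) (not_lt.1 h)]
    simp

end Sample

/-- Linearity of the jackknife applied to the Hoeffding decomposition. -/
theorem pseudoValue_eq {ν : Measure ℝ} {r n : ℕ} (hn : r + 2 ≤ n) (x : ℕ → ℝ) (k : Fin n) :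
    pseudoValue r n x k = pwm ν r + centredProjection ν r (x k) +
      jackknife r n (sampleRemainder ν r x) k := by
  have h : ∀ t : Finset ℕ, sampleMax t x = (((r : ℝ) + 1) * pwm ν r +
      ∑ j ∈ t, centredProjection ν r (x j)) + sampleRemainder ν r x t := by
    intro t
    rw [sampleRemainder]
    ring
  simp only [pseudoValue_eq_jackknife, h]
  rw [jackknife_add, jackknife_add, jackknife_const hn k.2, jackknife_sum hn k.2,
    mul_div_cancel_left₀ _ (by positivity : (r : ℝ) + 1 ≠ 0)]

/-! ### Negligibility of the remainder pseudo-values. -/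

theorem tendstoInMeasure_of_tendsto_integral {Ω : Type*} [MeasurableSpace Ω] {P : Measure Ω}
    [IsFiniteMeasure P] {Y : ℕ → Ω → ℝ} (h0 : ∀ n ω, 0 ≤ Y n ω)
    (hint : ∀ᶠ n in atTop, Integrable (Y n) P)
    (hlim : Tendsto (fun n => ∫ ω, Y n ω ∂P) atTop (nhds 0)) :
    TendstoInMeasure P Y atTop fun _ => (0 : ℝ) := by
  rw [tendstoInMeasure_iff_measureReal_norm]
  intro ε hε
  have hlim' := hlim.div_const ε
  rw [zero_div] at hlim'
  refine squeeze_zero' (Eventually.of_forall fun n => measureReal_nonneg) ?_ hlim'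
  filter_upwards [hint] with n hn
  rw [le_div_iff₀ hε, mul_comm]
  refine le_trans (le_of_eq ?_) (mul_meas_ge_le_integral_of_nonneg
    (Eventually.of_forall fun ω => h0 n ω) hn ε)
  simp only [sub_zero, Real.norm_of_nonneg (h0 n _)]

theorem TendstoInMeasure.of_sq {Ω : Type*} [MeasurableSpace Ω] {P : Measure Ω}
    {Y : ℕ → Ω → ℝ} (h : TendstoInMeasure P (fun n ω => Y n ω ^ 2) atTop fun _ => (0 : ℝ)) :
    TendstoInMeasure P Y atTop fun _ => (0 : ℝ) := by
  rw [tendstoInMeasure_iff_norm] at h ⊢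
  intro ε hε
  refine (h (ε ^ 2) (by positivity)).congr fun n => ?_
  congr 1
  ext ω
  simp only [sub_zero, norm_pow, Set.mem_ofPred_eq]
  exact pow_le_pow_iff_left₀ hε.le (norm_nonneg _) two_ne_zero

section Sample

variable {Ω : Type*} [MeasurableSpace Ω] {P : Measure Ω} [IsProbabilityMeasure P]
  {X : ℕ → Ω → ℝ} {ν : Measure ℝ} {r : ℕ}

variable [IsProbabilityMeasure ν]

theorem memLp_sum_sampleRemainder
    (hX : ∀ i, Measurable (X i)) (hindep : iIndepFun X P) (hlaw : ∀ i, P.map (X i) = ν)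
    (hmom : MemLp (pwmKernel r) 2 (Measure.pi fun _ : Fin (r + 1) => ν))
    {ι : Type*} (J : Finset ι) (τ : ι → Finset ℕ) (hτ : ∀ j ∈ J, (τ j).card = r + 1) :
    MemLp (fun ω => ∑ j ∈ J, sampleRemainder ν r (fun i => X i ω) (τ j)) 2 P :=
  memLp_finsetSum _ fun j hj => memLp_sampleRemainder hX hindep hlaw hmom (hτ j hj)

theorem memLp_uStat_sampleRemainder
    (hX : ∀ i, Measurable (X i)) (hindep : iIndepFun X P) (hlaw : ∀ i, P.map (X i) = ν)
    (hmom : MemLp (pwmKernel r) 2 (Measure.pi fun _ : Fin (r + 1) => ν)) (s : Finset ℕ) :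
    MemLp (fun ω => uStat (r + 1) s (sampleRemainder ν r fun i => X i ω)) 2 P := by
  simp only [uStat, div_eq_mul_inv]
  exact (memLp_sum_sampleRemainder hX hindep hlaw hmom _ (fun t => t)
    fun t ht => (mem_powersetCard.1 ht).2).mul_const _

theorem integral_uStat_sampleRemainder_sq_le [NullSingletonClass ν] (hr : 1 ≤ r)
    (hX : ∀ i, Measurable (X i)) (hindep : iIndepFun X P) (hlaw : ∀ i, P.map (X i) = ν)
    (hmom : MemLp (pwmKernel r) 2 (Measure.pi fun _ : Fin (r + 1) => ν)) {s : Finset ℕ}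
    (hs : r + 1 ≤ s.card) :
    ∫ ω, uStat (r + 1) s (sampleRemainder ν r fun i => X i ω) ^ 2 ∂P ≤
      (∫ z, kernelRemainder ν r z ^ 2 ∂(Measure.pi fun _ : Fin (r + 1) => ν)) *
        (((r : ℝ) * (r + 1)) ^ 2 / (s.card * ((s.card : ℝ) - 1))) := by
  have hc : 0 < (s.card.choose (r + 1) : ℝ) := by exact_mod_cast Nat.choose_pos hs
  simp only [uStat, div_pow]
  rw [integral_div, div_le_iff₀ (by positivity), mul_assoc]
  refine (integral_sum_sampleRemainder_sq_le hX hindep hlaw hmom _ (fun t => t)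
    fun t ht => (mem_powersetCard.1 ht).2).trans ?_
  refine mul_le_mul_of_nonneg_left ?_ (integral_nonneg fun z => sq_nonneg _)
  rw [mul_comm]
  exact card_pairs_one_lt_card_inter_le hr hs

theorem card_insert_of_mem_powersetCard {s t : Finset ℕ} {k m : ℕ} (hk : k ∉ s)
    (ht : t ∈ s.powersetCard m) : (insert k t).card = m + 1 := by
  obtain ⟨h1, h2⟩ := mem_powersetCard.1 ht
  rw [card_insert_of_notMem fun h => hk (h1 h), h2]

theorem memLp_uStat_sampleRemainder_insert
    (hX : ∀ i, Measurable (X i)) (hindep : iIndepFun X P) (hlaw : ∀ i, P.map (X i) = ν)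
    (hmom : MemLp (pwmKernel r) 2 (Measure.pi fun _ : Fin (r + 1) => ν)) {s : Finset ℕ}
    {k : ℕ} (hk : k ∉ s) :
    MemLp (fun ω => uStat r s fun t => sampleRemainder ν r (fun i => X i ω) (insert k t)) 2 P := by
  simp only [uStat, div_eq_mul_inv]
  exact (memLp_sum_sampleRemainder hX hindep hlaw hmom _ (fun t => insert k t)
    fun t ht => card_insert_of_mem_powersetCard hk ht).mul_const _

theorem integral_uStat_sampleRemainder_insert_sq_le [NullSingletonClass ν] (hr : 1 ≤ r)
    (hX : ∀ i, Measurable (X i)) (hindep : iIndepFun X P) (hlaw : ∀ i, P.map (X i) = ν)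
    (hmom : MemLp (pwmKernel r) 2 (Measure.pi fun _ : Fin (r + 1) => ν)) {s : Finset ℕ}
    (hs : r ≤ s.card) {k : ℕ} (hk : k ∉ s) :
    ∫ ω, uStat r s (fun t => sampleRemainder ν r (fun i => X i ω) (insert k t)) ^ 2 ∂P ≤
      (∫ z, kernelRemainder ν r z ^ 2 ∂(Measure.pi fun _ : Fin (r + 1) => ν)) *
        ((r : ℝ) ^ 2 / s.card) := by
  have hc : 0 < (s.card.choose r : ℝ) := by exact_mod_cast Nat.choose_pos hs
  simp only [uStat, div_pow]
  rw [integral_div, div_le_iff₀ (by positivity), mul_assoc]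
  refine (integral_sum_sampleRemainder_sq_le hX hindep hlaw hmom _ (fun t => insert k t)
    fun t ht => card_insert_of_mem_powersetCard hk ht).trans ?_
  refine mul_le_mul_of_nonneg_left ?_ (integral_nonneg fun z => sq_nonneg _)
  rw [mul_comm]
  refine le_trans (Nat.cast_le.2 (card_le_card fun p hp => ?_))
    (card_pairs_inter_nonempty_le hr hs)
  obtain ⟨hp1, hp2⟩ := mem_filter.1 hp
  refine mem_filter.2 ⟨hp1, card_pos.1 ?_⟩
  -- The inserted `k` is one common element, so a second one forces the original `r`-subsets to
  -- meet.
  have hnot : k ∉ p.1 ∩ p.2 := fun h =>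
    hk ((mem_powersetCard.1 (mem_product.1 hp1).1).1 (mem_inter.1 h).1)
  rw [← insert_inter_distrib, card_insert_of_notMem hnot] at hp2
  omega

theorem memLp_jackknife_sampleRemainder
    (hX : ∀ i, Measurable (X i)) (hindep : iIndepFun X P) (hlaw : ∀ i, P.map (X i) = ν)
    (hmom : MemLp (pwmKernel r) 2 (Measure.pi fun _ : Fin (r + 1) => ν)) (n k : ℕ) :
    MemLp (fun ω => jackknife r n (sampleRemainder ν r fun i => X i ω) k) 2 P := by
  have h := memLp_uStat_sampleRemainder hX hindep hlaw hmom
  simp only [jackknife, div_eq_mul_inv]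
  exact (((h _).const_mul _).sub ((h _).const_mul _)).mul_const _

/-- The pseudo-values of the remainder have second moments of order `1 / n`. -/
theorem exists_integral_jackknife_sampleRemainder_sq_le [NullSingletonClass ν] (hr : 1 ≤ r)
    (hX : ∀ i, Measurable (X i)) (hindep : iIndepFun X P) (hlaw : ∀ i, P.map (X i) = ν)
    (hmom : MemLp (pwmKernel r) 2 (Measure.pi fun _ : Fin (r + 1) => ν)) :
    ∃ C : ℝ, ∀ n k, r + 2 ≤ n → k < n →
      ∫ ω, jackknife r n (sampleRemainder ν r fun i => X i ω) k ^ 2 ∂P ≤ C / ((n : ℝ) - 1) := by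
  set c := ∫ z, kernelRemainder ν r z ^ 2 ∂(Measure.pi fun _ : Fin (r + 1) => ν) with hc
  have hc0 : 0 ≤ c := integral_nonneg fun z => sq_nonneg _
  refine ⟨2 * c * ((r : ℝ) ^ 2 + ((r : ℝ) * (r + 1)) ^ 2), fun n k hn hk => ?_⟩
  have hk' : k ∈ range n := by simpa using hk
  have hcard : ((range n).erase k).card = n - 1 := by rw [card_erase_of_mem hk', card_range]
  have hnot := notMem_erase k (range n)
  have hA := integral_uStat_sampleRemainder_insert_sq_le hr hX hindep hlaw hmom
    (s := (range n).erase k) (by omega) hnot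
  have hD := integral_uStat_sampleRemainder_sq_le hr hX hindep hlaw hmom
    (s := (range n).erase k) (by omega)
  have hAi := (memLp_uStat_sampleRemainder_insert hX hindep hlaw hmom hnot).integrable_sq
  have hDi := (memLp_uStat_sampleRemainder hX hindep hlaw hmom
    ((range n).erase k)).integrable_sq
  have hN : (((n - 1 : ℕ) : ℝ)) = (n : ℝ) - 1 := by
    rw [Nat.cast_sub (by omega)]; simp
  rw [hcard, hN] at hA hD
  -- From `1 ≤ r`; it gives `n - 2 ≥ 1`, so the `O(n⁻²)` term is absorbed into `O(1 / (n - 1))`.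
  have hn3 : (3 : ℝ) ≤ n := by exact_mod_cast (by omega : 3 ≤ n)
  have hle : ∫ ω, jackknife r n (sampleRemainder ν r fun i => X i ω) k ^ 2 ∂P ≤
      ∫ ω, 2 * (uStat r ((range n).erase k)
          (fun t => sampleRemainder ν r (fun i => X i ω) (insert k t)) ^ 2 +
        uStat (r + 1) ((range n).erase k) (sampleRemainder ν r fun i => X i ω) ^ 2) ∂P := by
    refine integral_mono (memLp_jackknife_sampleRemainder hX hindep hlaw hmom n k).integrable_sq
      ((hAi.add hDi).const_mul 2) fun ω => ?_
    simp only
    rw [jackknife_eq hn hk]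
    set A := uStat r ((range n).erase k)
      (fun t => sampleRemainder ν r (fun i => X i ω) (insert k t))
    set D := uStat (r + 1) ((range n).erase k) (sampleRemainder ν r fun i => X i ω)
    have hq0 : 0 ≤ (r : ℝ) / ((r : ℝ) + 1) := by positivity
    have hq1 : (r : ℝ) / ((r : ℝ) + 1) ≤ 1 := by
      rw [div_le_one (by positivity)]; linarith
    have hq2 : ((r : ℝ) / ((r : ℝ) + 1)) ^ 2 ≤ 1 := pow_le_one₀ hq0 hq1
    nlinarith [sq_nonneg (A + (r : ℝ) / ((r : ℝ) + 1) * D), sq_nonneg D]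
  refine hle.trans ?_
  rw [integral_const_mul, integral_add hAi hDi]
  have hD' : c * (((r : ℝ) * (r + 1)) ^ 2 / (((n : ℝ) - 1) * ((n : ℝ) - 1 - 1))) ≤
      c * (((r : ℝ) * (r + 1)) ^ 2 / ((n : ℝ) - 1)) := by
    refine mul_le_mul_of_nonneg_left ?_ hc0
    refine div_le_div_of_nonneg_left (by positivity) (by linarith) ?_
    nlinarith
  have hfin : 2 * (c * ((r : ℝ) ^ 2 / ((n : ℝ) - 1)) +
      c * (((r : ℝ) * (r + 1)) ^ 2 / ((n : ℝ) - 1))) =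
      2 * c * ((r : ℝ) ^ 2 + ((r : ℝ) * (r + 1)) ^ 2) / ((n : ℝ) - 1) := by ring
  linarith

theorem tendsto_const_div_natCast_sub_one (C : ℝ) :
    Tendsto (fun n : ℕ => C / ((n : ℝ) - 1)) atTop (nhds 0) :=
  tendsto_const_nhds.div_atTop
    (tendsto_atTop_add_const_right _ (-1) tendsto_natCast_atTop_atTop)

theorem tendstoInMeasure_mean_sq_jackknife_sampleRemainder [NullSingletonClass ν] (hr : 1 ≤ r)
    (hX : ∀ i, Measurable (X i)) (hindep : iIndepFun X P) (hlaw : ∀ i, P.map (X i) = ν)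
    (hmom : MemLp (pwmKernel r) 2 (Measure.pi fun _ : Fin (r + 1) => ν)) :
    TendstoInMeasure P (fun n ω => (∑ k ∈ range n,
      jackknife r n (sampleRemainder ν r fun i => X i ω) k ^ 2) / (n : ℝ)) atTop
      fun _ => (0 : ℝ) := by
  obtain ⟨C, hC⟩ := exists_integral_jackknife_sampleRemainder_sq_le hr hX hindep hlaw hmom
  have hi := fun n k => (memLp_jackknife_sampleRemainder hX hindep hlaw hmom n k).integrable_sq
  refine tendstoInMeasure_of_tendsto_integral
    (fun n ω => div_nonneg (sum_nonneg fun _ _ => sq_nonneg _) (Nat.cast_nonneg n))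
    (Eventually.of_forall fun n => (integrable_finsetSum _ fun k _ => hi n k).div_const _) ?_
  refine squeeze_zero' (Eventually.of_forall fun n => integral_nonneg fun ω =>
    div_nonneg (sum_nonneg fun _ _ => sq_nonneg _) (Nat.cast_nonneg n)) ?_
    (tendsto_const_div_natCast_sub_one C)
  filter_upwards [eventually_ge_atTop (r + 2)] with n hn
  have hn0 : (0 : ℝ) < n := by exact_mod_cast (by omega : 0 < n)
  rw [integral_div, integral_finsetSum _ fun k _ => hi n k, div_le_iff₀ hn0]
  refine (sum_le_sum fun k hk => hC n k hn (mem_range.1 hk)).trans (le_of_eq ?_)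
  simp [mul_comm]

/-- Individual bounds `E R_k ^ 2 = O(1 / n)` with Cauchy–Schwarz would give only boundedness.
Instead the sum is `n / (r + 1)` times the degenerate U-statistic, whose second moment is `O(n⁻²)`.
-/
theorem tendstoInMeasure_sum_jackknife_sampleRemainder [NullSingletonClass ν] (hr : 1 ≤ r)
    (hX : ∀ i, Measurable (X i)) (hindep : iIndepFun X P) (hlaw : ∀ i, P.map (X i) = ν)
    (hmom : MemLp (pwmKernel r) 2 (Measure.pi fun _ : Fin (r + 1) => ν)) :
    TendstoInMeasure P (fun n ω => (∑ k ∈ range n,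
      jackknife r n (sampleRemainder ν r fun i => X i ω) k) / √(n : ℝ)) atTop
      fun _ => (0 : ℝ) := by
  refine TendstoInMeasure.of_sq ?_
  set c := ∫ z, kernelRemainder ν r z ^ 2 ∂(Measure.pi fun _ : Fin (r + 1) => ν) with hc
  have hL := fun n => memLp_finsetSum (range n) fun k (_ : k ∈ range n) =>
    memLp_jackknife_sampleRemainder hX hindep hlaw hmom n k
  refine tendstoInMeasure_of_tendsto_integral (fun n ω => sq_nonneg _)
    (Eventually.of_forall fun n => ?_) ?_
  · simp only [div_pow]
    exact (hL n).integrable_sq.div_const _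
  refine squeeze_zero' (Eventually.of_forall fun n => integral_nonneg fun ω => sq_nonneg _) ?_
    (tendsto_const_div_natCast_sub_one (c * (r : ℝ) ^ 2))
  filter_upwards [eventually_ge_atTop (r + 2)] with n hn
  have hn1 : (1 : ℝ) < n := by exact_mod_cast (by omega : 1 < n)
  have hn0 : (0 : ℝ) < n := by linarith
  have hD := integral_uStat_sampleRemainder_sq_le hr hX hindep hlaw hmom (s := range n)
    (by simp; omega)
  rw [← hc, card_range] at hD
  have h1 : ∀ ω, ((∑ k ∈ range n, jackknife r n (sampleRemainder ν r fun i => X i ω) k) /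
      √(n : ℝ)) ^ 2 = uStat (r + 1) (range n) (sampleRemainder ν r fun i => X i ω) ^ 2 *
        (n / ((r : ℝ) + 1) ^ 2) := by
    intro ω
    rw [sum_jackknife hn, div_pow, Real.sq_sqrt hn0.le]
    field_simp
  simp only [h1]
  rw [integral_mul_const]
  refine (mul_le_mul_of_nonneg_right hD (by positivity)).trans (le_of_eq ?_)
  have : (n : ℝ) - 1 ≠ 0 := by linarith
  field_simp

end Sample

/-! ### Limit theorems for the leading terms. -/

theorem le_sampleMax {ι : Type*} {s : Finset ι} (x : ι → ℝ) {i : ι} (hi : i ∈ s) :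
    x i ≤ sampleMax s x := by
  rw [sampleMax_of_nonempty ⟨i, hi⟩]
  exact Finset.le_sup' x hi

theorem sampleMax_le {ι : Type*} {s : Finset ι} {x : ι → ℝ} {c : ℝ} (hc : 0 ≤ c)
    (h : ∀ i ∈ s, x i ≤ c) : sampleMax s x ≤ c := by
  by_cases hs : s.Nonempty
  · rw [sampleMax_of_nonempty hs]
    exact Finset.sup'_le hs x h
  · simpa [sampleMax, hs] using hc

theorem sampleMax_nonneg {ι : Type*} {s : Finset ι} {x : ι → ℝ} (h : ∀ i ∈ s, 0 ≤ x i) :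
    0 ≤ sampleMax s x := by
  by_cases hs : s.Nonempty
  · obtain ⟨i, hi⟩ := hs
    exact (h i hi).trans (le_sampleMax x hi)
  · simp [sampleMax, hs]

/-- If the means of the squares converge, the largest term is `o (√n)`. -/
theorem tendsto_sampleMax_div_sqrt {c : ℕ → ℝ} {L : ℝ}
    (h : Tendsto (fun n : ℕ => (∑ k ∈ range n, c k ^ 2) / (n : ℝ)) atTop (nhds L)) :
    Tendsto (fun n : ℕ => sampleMax (range n) (fun k => |c k|) / √(n : ℝ)) atTop (nhds 0) := by
  -- A single term is the difference of two consecutive sums, whose normalized versions share a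
  -- limit.
  have hterm : Tendsto (fun n : ℕ => c n ^ 2 / ((n : ℝ) + 1)) atTop (nhds 0) := by
    have h1 := h.comp (tendsto_add_atTop_nat 1)
    have h2 := h.mul (tendsto_natCast_div_add_atTop (1 : ℝ))
    have h3 := h1.sub h2
    rw [mul_one, sub_self] at h3
    refine h3.congr' ?_
    filter_upwards [eventually_gt_atTop 0] with n hn
    have hn0 : (n : ℝ) ≠ 0 := by exact_mod_cast hn.ne'
    have hn1 : (n : ℝ) + 1 ≠ 0 := by positivity
    simp only [Function.comp_apply, sum_range_succ, Nat.cast_add, Nat.cast_one]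
    field_simp
    ring
  rw [Metric.tendsto_atTop] at hterm ⊢
  intro ε hε
  obtain ⟨N, hN⟩ := hterm ((ε / 2) ^ 2) (by positivity)
  -- The finitely many terms before `N` are bounded by the constant `B`, eventually below `ε / 2 *
  -- √n`.
  set B := ∑ k ∈ range N, |c k| with hB
  have hB0 : 0 ≤ B := sum_nonneg fun _ _ => abs_nonneg _
  obtain ⟨N', hN'⟩ := exists_nat_gt ((B / (ε / 2)) ^ 2)
  refine ⟨max N' 1, fun n hn => ?_⟩
  have hn1 : 1 ≤ n := (le_max_right _ _).trans hn
  have hn0 : (0 : ℝ) < n := by exact_mod_cast hn1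
  have hsq : 0 < √(n : ℝ) := Real.sqrt_pos.2 hn0
  have hBn : B ≤ ε / 2 * √(n : ℝ) := by
    rw [← div_le_iff₀' (by positivity)]
    refine Real.le_sqrt_of_sq_le (hN'.le.trans ?_)
    exact_mod_cast (le_max_left _ _).trans hn
  rw [Real.dist_eq, sub_zero, abs_of_nonneg
    (div_nonneg (sampleMax_nonneg fun _ _ => abs_nonneg _) hsq.le), div_lt_iff₀ hsq]
  refine lt_of_le_of_lt (sampleMax_le (c := ε / 2 * √(n : ℝ)) (by positivity) fun k hk => ?_)
    (by nlinarith [mul_pos hε hsq])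
  rcases lt_or_ge k N with hkN | hkN
  · refine le_trans ?_ hBn
    exact single_le_sum (f := fun k => |c k|) (fun _ _ => abs_nonneg _) (mem_range.2 hkN)
  · have h1 := hN k hkN
    have hk0 : (0 : ℝ) < (k : ℝ) + 1 := by positivity
    rw [Real.dist_eq, sub_zero, abs_of_nonneg (by positivity), div_lt_iff₀ hk0] at h1
    have hkn : (k : ℝ) + 1 ≤ n := by exact_mod_cast mem_range.1 hk
    refine abs_le_of_sq_le_sq ?_ (by positivity)
    rw [mul_pow, Real.sq_sqrt hn0.le]
    exact h1.le.trans (mul_le_mul_of_nonneg_left hkn (by positivity))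

section IID

variable {Ω : Type*} [MeasurableSpace Ω] {P : Measure Ω}
  {X : ℕ → Ω → ℝ} {ν : Measure ℝ} {g : ℝ → ℝ}

theorem identDistrib_comp (hX : ∀ i, Measurable (X i)) (hlaw : ∀ i, P.map (X i) = ν)
    (hg : Measurable g) (i : ℕ) :
    IdentDistrib (fun ω => g (X i ω)) (fun ω => g (X 0 ω)) P P :=
  (⟨(hX i).aemeasurable, (hX 0).aemeasurable, by rw [hlaw, hlaw]⟩ :
    IdentDistrib (X i) (X 0) P P).comp hg

theorem memLp_comp (hX : ∀ i, Measurable (X i)) (hlaw : ∀ i, P.map (X i) = ν)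
    (hg2 : MemLp g 2 ν) (i : ℕ) : MemLp (fun ω => g (X i ω)) 2 P :=
  hg2.comp_measurePreserving ⟨hX i, hlaw i⟩

theorem integral_comp_law (hX : ∀ i, Measurable (X i)) (hlaw : ∀ i, P.map (X i) = ν)
    {f : ℝ → ℝ} (hf : Measurable f) (i : ℕ) : ∫ ω, f (X i ω) ∂P = ∫ x, f x ∂ν := by
  rw [← hlaw i, integral_map (hX i).aemeasurable hf.aestronglyMeasurable]

theorem ae_tendsto_mean_sq (hX : ∀ i, Measurable (X i)) (hindep : iIndepFun X P)
    (hlaw : ∀ i, P.map (X i) = ν) (hg : Measurable g) (hg2 : MemLp g 2 ν) :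
    ∀ᵐ ω ∂P, Tendsto (fun n : ℕ => (∑ k ∈ range n, g (X k ω) ^ 2) / (n : ℝ)) atTop
      (nhds (∫ x, g x ^ 2 ∂ν)) := by
  have h := strong_law_ae_real (μ := P) (fun i ω => g (X i ω) ^ 2)
    (memLp_comp hX hlaw hg2 0).integrable_sq
    (fun i j hij => (hindep.indepFun hij).comp (hg.pow_const 2) (hg.pow_const 2))
    (fun i => identDistrib_comp hX hlaw (hg.pow_const 2) i)
  rwa [integral_comp_law hX hlaw (hg.pow_const 2)] at h

variable [IsProbabilityMeasure P]

theorem tendstoInMeasure_mean_sq (hX : ∀ i, Measurable (X i)) (hindep : iIndepFun X P)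
    (hlaw : ∀ i, P.map (X i) = ν) (hg : Measurable g) (hg2 : MemLp g 2 ν) :
    TendstoInMeasure P (fun (n : ℕ) ω => (∑ k ∈ range n, g (X k ω) ^ 2) / (n : ℝ)) atTop
      fun _ => ∫ x, g x ^ 2 ∂ν := by
  refine tendstoInMeasure_of_tendsto_ae (fun n => ?_) (ae_tendsto_mean_sq hX hindep hlaw hg hg2)
  exact Measurable.aestronglyMeasurable (by fun_prop)

theorem tendstoInMeasure_sampleMax_div_sqrt (hX : ∀ i, Measurable (X i)) (hindep : iIndepFun X P)
    (hlaw : ∀ i, P.map (X i) = ν) (hg : Measurable g) (hg2 : MemLp g 2 ν) :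
    TendstoInMeasure P (fun (n : ℕ) ω => sampleMax (range n) (fun k => |g (X k ω)|) / √(n : ℝ))
      atTop fun _ => (0 : ℝ) := by
  refine tendstoInMeasure_of_tendsto_ae (fun n => ?_) ?_
  · have h := (measurable_sampleMax (range n)).comp (measurable_pi_lambda
      (fun ω k => |g (X k ω)|) fun k => by fun_prop)
    exact (h.div_const _).aestronglyMeasurable
  · filter_upwards [ae_tendsto_mean_sq hX hindep hlaw hg hg2] with ω hω
    exact tendsto_sampleMax_div_sqrt hω

/-- Chebyshev's inequality for normalized sums. -/
theorem measure_lt_abs_sum_div_sqrt_le (hX : ∀ i, Measurable (X i)) (hindep : iIndepFun X P)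
    (hlaw : ∀ i, P.map (X i) = ν) (hg : Measurable g) (hg2 : MemLp g 2 ν)
    (hg0 : ∫ x, g x ∂ν = 0) (n : ℕ) {K : ℝ} (hK : 0 < K) :
    P {ω | K < |(∑ k ∈ range n, g (X k ω)) / √(n : ℝ)|} ≤
      ENNReal.ofReal ((∫ x, g x ^ 2 ∂ν) / K ^ 2) := by
  have hL := memLp_comp hX hlaw hg2
  have hS : MemLp (∑ k ∈ range n, fun ω => g (X k ω)) 2 P := memLp_finsetSum' _ fun k _ => hL k
  have hmean : ∀ k, ∫ ω, g (X k ω) ∂P = 0 := fun k => by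
    rw [integral_comp_law hX hlaw hg, hg0]
  have hvar : variance (∑ k ∈ range n, fun ω => g (X k ω)) P = n * ∫ x, g x ^ 2 ∂ν := by
    rw [IndepFun.variance_sum (fun k _ => hL k)
      (fun i _ j _ hij => (hindep.indepFun hij).comp hg hg)]
    have : ∀ k ∈ range n, variance (fun ω => g (X k ω)) P = ∫ x, g x ^ 2 ∂ν := fun k _ => by
      rw [variance_of_integral_eq_zero (hL k).aemeasurable (hmean k),
        integral_comp_law hX hlaw (hg.pow_const 2)]
    rw [sum_congr rfl this]
    simp
  have hmeanS : ∫ ω, (∑ k ∈ range n, fun ω => g (X k ω)) ω ∂P = 0 := by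
    simp only [Finset.sum_apply]
    rw [integral_finsetSum _ fun k _ => (hL k).integrable one_le_two]
    simp [hmean]
  -- For `n = 0` the quotient is `0 / 0 = 0`, so the event is empty.
  rcases Nat.eq_zero_or_pos n with rfl | hn
  · simp [not_lt.2 hK.le]
  have hn0 : (0 : ℝ) < n := by exact_mod_cast hn
  have hsq : 0 < √(n : ℝ) := Real.sqrt_pos.2 hn0
  have h := meas_ge_le_variance_div_sq hS (c := K * √(n : ℝ)) (by positivity)
  rw [hvar, hmeanS, mul_pow, Real.sq_sqrt hn0.le] at h
  refine (measure_mono fun ω hω => ?_).trans (h.trans (le_of_eq ?_))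
  · simp only [Set.mem_ofPred_eq, abs_div, abs_of_pos hsq, lt_div_iff₀ hsq] at hω
    simpa only [Set.mem_ofPred_eq, Finset.sum_apply, sub_zero] using hω.le
  · congr 1
    field_simp

theorem tendstoInDistribution_sq_sum_div (hX : ∀ i, Measurable (X i)) (hindep : iIndepFun X P)
    (hlaw : ∀ i, P.map (X i) = ν) (hg : Measurable g)
    (hg0 : ∫ x, g x ∂ν = 0) (hpos : 0 < ∫ x, g x ^ 2 ∂ν) :
    TendstoInDistribution (fun (n : ℕ) ω =>
      ((∑ k ∈ range n, g (X k ω)) / √(n : ℝ)) ^ 2 / ∫ x, g x ^ 2 ∂ν)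
      atTop (fun u : ℝ => u ^ 2) (fun _ => P) (gaussianReal 0 1) := by
  set v := ∫ x, g x ^ 2 ∂ν with hv
  have hgv : Measurable fun x => g x / √v := hg.div_const _
  have h := tendstoInDistribution_inv_sqrt_mul_sum (P := P) (P' := gaussianReal 0 1)
    (X := fun i ω => g (X i ω) / √v) (Y := id) HasLaw.id
    (by rw [integral_div, integral_comp_law hX hlaw hg, hg0, zero_div])
    (by
      have : ∫ ω, g (X 0 ω) ^ 2 ∂P = v := integral_comp_law hX hlaw (hg.pow_const 2) 0
      simp only [Pi.pow_apply, div_pow, Real.sq_sqrt hpos.le]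
      rw [integral_div, this, div_self hpos.ne'])
    (hindep.comp (fun _ x => g x / √v) fun _ => hgv)
    (fun i => identDistrib_comp hX hlaw hgv i)
  have h2 := h.continuous_comp (g := fun u : ℝ => u ^ 2) (by fun_prop)
  convert h2 using 3 with n ω
  swap
  · rfl
  simp only [Function.comp_apply]
  rw [← sum_div, mul_pow, div_pow, div_pow, Real.sq_sqrt hpos.le, inv_pow]
  ring

end IID

/-! ### From deterministic error bounds to convergence in probability. -/

/-- A property that holds when `T` is bounded and `Y` is close to its limit in probability holds
with probability tending to one if `T` is tight. -/
theorem tendsto_measure_not_of_tight {Ω J : Type*} [MeasurableSpace Ω] [Fintype J]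
    {P : Measure Ω} {T : ℕ → Ω → ℝ} {Y : J → ℕ → Ω → ℝ} {y : J → ℝ} {Good : ℕ → Ω → Prop}
    (hT : ∀ ε : ENNReal, 0 < ε → ∃ K : ℝ, ∀ n, P {ω | K < |T n ω|} ≤ ε)
    (hY : ∀ j, TendstoInMeasure P (Y j) atTop fun _ => y j)
    (hGood : ∀ K : ℝ, ∃ U ∈ nhds y, ∀ᶠ n in atTop, ∀ ω, |T n ω| ≤ K →
      (fun j => Y j n ω) ∈ U → Good n ω) :
    Tendsto (fun n => P {ω | ¬ Good n ω}) atTop (nhds 0) := by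
  rw [ENNReal.tendsto_nhds_zero]
  intro ε hε
  obtain ⟨K, hK⟩ := hT (ε / 2) (ENNReal.half_pos hε.ne')
  obtain ⟨U, hU, hev⟩ := hGood K
  obtain ⟨δ, hδ, hball⟩ := Metric.mem_nhds_iff.1 hU
  have hsum : Tendsto (fun n => ∑ j, P {ω | δ ≤ dist (Y j n ω) (y j)}) atTop (nhds 0) := by
    have h := tendsto_finsetSum univ fun j (_ : j ∈ univ) =>
      (tendstoInMeasure_iff_dist.1 (hY j)) δ hδ
    simpa using h
  filter_upwards [hev, ENNReal.tendsto_nhds_zero.1 hsum (ε / 2) (ENNReal.half_pos hε.ne')]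
    with n hn hn2
  have hsub : {ω | ¬ Good n ω} ⊆ {ω | K < |T n ω|} ∪ ⋃ j ∈ univ, {ω | δ ≤ dist (Y j n ω) (y j)} := by
    intro ω hω
    by_contra hcon
    simp only [Set.mem_union, Set.mem_ofPred_eq, Set.mem_iUnion, not_or, not_lt, not_exists,
      not_le] at hcon
    exact hω (hn ω hcon.1 (hball ((dist_pi_lt_iff hδ).2 fun j => hcon.2 j (mem_univ j))))
  refine (measure_mono hsub).trans ((measure_union_le _ _).trans ?_)
  rw [← ENNReal.add_halves ε]
  exact add_le_add (hK n) ((measure_biUnion_finset_le _ _).trans hn2)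

theorem TendstoInMeasure.of_abs_le_add {Ω : Type*} [MeasurableSpace Ω] {P : Measure Ω}
    {f f' : ℕ → Ω → ℝ} {c : ℕ → ℝ} (h : TendstoInMeasure P f atTop fun _ => (0 : ℝ))
    (hc : Tendsto c atTop (nhds 0)) (hle : ∀ᶠ n in atTop, ∀ ω, |f' n ω| ≤ |f n ω| + c n) :
    TendstoInMeasure P f' atTop fun _ => (0 : ℝ) := by
  rw [tendstoInMeasure_iff_norm] at h ⊢
  intro ε hε
  refine tendsto_of_tendsto_of_tendsto_of_le_of_le' tendsto_const_nhds (h (ε / 2) (by positivity))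
    (Eventually.of_forall fun n => zero_le) ?_
  filter_upwards [hle, hc.eventually (gt_mem_nhds (half_pos hε))] with n hn hcn
  refine measure_mono fun ω hω => ?_
  simp only [sub_zero, Real.norm_eq_abs, Set.mem_ofPred_eq] at hω ⊢
  linarith [hn ω]

/-! The statistic is compared with `G ^ 2 / v` in terms of the sum `G` of the leading parts `c k`
of the scaled values `c k + d k` and of six quantities `y`: the sum of the `d k ^ 2`, the sum of
the `d k`, the sum of the `c k ^ 2`, a bound for the `|c k|`, and the two coefficients of the
scaled added value, which is `- y 4 * ∑ (c k + d k) - y 5`. -/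

/-- The scaled added value. -/
def scaledAdded (G : ℝ) (y : Fin 6 → ℝ) : ℝ := -(y 4) * (G + y 1) - y 5

/-- The sum of all scaled values. -/
def scaledSum (G : ℝ) (y : Fin 6 → ℝ) : ℝ := G + y 1 + scaledAdded G y

/-- A bound for the effect of the `d k` on the sum of squares. -/
noncomputable def sqDefect (y : Fin 6 → ℝ) : ℝ := 2 * √(y 2 * y 0) + y 0

/-- A bound for the modulus of all scaled values. -/
noncomputable def scaledBound (G : ℝ) (y : Fin 6 → ℝ) : ℝ :=
  y 3 + √(y 0) + |scaledAdded G y|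

/-- A bound for the distance of the statistic from `G ^ 2 / v`. -/
noncomputable def wilksError (v G : ℝ) (y : Fin 6 → ℝ) : ℝ :=
  64 * |scaledSum G y| ^ 4 * scaledBound G y ^ 2 / (y 2 - sqDefect y) ^ 3 +
    32 * |scaledSum G y| ^ 3 * scaledBound G y / (y 2 - sqDefect y) ^ 2 +
    (|scaledSum G y ^ 2 - G ^ 2| / (y 2 - sqDefect y) +
      G ^ 2 * (|y 2 - v| + sqDefect y + scaledAdded G y ^ 2) / ((y 2 - sqDefect y) * v))

/-- The quadratic expansion applies to all `n + 1` values. Cauchy–Schwarz bounds the cross term `∑ c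
k * d k`, so the sum of squares is at least `y 2 - sqDefect y`, which replaces it in every
denominator. -/
theorem abs_neg_two_mul_log_elRatio_snoc_sub_le {n : ℕ} {c d : Fin n → ℝ} {G v z : ℝ}
    {y : Fin 6 → ℝ} (hv : 0 < v) (hG : ∑ k, c k = G) (h0 : ∑ k, d k ^ 2 = y 0)
    (h1 : ∑ k, d k = y 1) (h2 : ∑ k, c k ^ 2 = y 2) (h3 : ∀ k, |c k| ≤ y 3) (h3' : 0 ≤ y 3)
    (hz : z = scaledAdded G y) (hs : 0 < y 2 - sqDefect y)
    (hsmall : 4 * scaledBound G y * |scaledSum G y| ≤ y 2 - sqDefect y) :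
    |-2 * Real.log (elRatio (Fin.snoc (fun k => c k + d k) z : Fin (n + 1) → ℝ)) - G ^ 2 / v| ≤
      wilksError v G y := by
  set w : Fin (n + 1) → ℝ := Fin.snoc (fun k => c k + d k) z with hw
  set s := y 2 - sqDefect y with hsdef
  have hy0 : 0 ≤ y 0 := h0 ▸ sum_nonneg fun _ _ => sq_nonneg _
  have hy2 : 0 ≤ y 2 := h2 ▸ sum_nonneg fun _ _ => sq_nonneg _
  have hT : ∑ k, w k = scaledSum G y := by
    rw [hw, Fin.sum_univ_castSucc]
    simp only [Fin.snoc_castSucc, Fin.snoc_last]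
    rw [sum_add_distrib, hG, h1, hz, scaledSum]
  have hcd : |∑ k, c k * d k| ≤ √(y 2 * y 0) := by
    refine Real.abs_le_sqrt ?_
    rw [← h2, ← h0]
    exact sum_mul_sq_le_sq_mul_sq _ _ _
  have hS : ∑ k, w k ^ 2 = y 2 + 2 * ∑ k, c k * d k + y 0 + scaledAdded G y ^ 2 := by
    rw [hw, Fin.sum_univ_castSucc]
    simp only [Fin.snoc_castSucc, Fin.snoc_last]
    rw [← h2, ← h0, ← hz, mul_sum, ← sum_add_distrib, ← sum_add_distrib]
    congr 1
    exact sum_congr rfl fun k _ => by ring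
  have hcd' := abs_le.1 hcd
  have hsS : s ≤ ∑ k, w k ^ 2 := by
    rw [hS, hsdef, sqDefect]
    nlinarith [sq_nonneg (scaledAdded G y)]
  have hSv : |∑ k, w k ^ 2 - v| ≤ |y 2 - v| + sqDefect y + scaledAdded G y ^ 2 := by
    rw [hS, sqDefect, abs_le]
    have := abs_le.1 (le_refl |y 2 - v|)
    constructor <;> nlinarith [sq_nonneg (scaledAdded G y)]
  have hM : ∀ k, |w k| ≤ scaledBound G y := by
    intro k
    refine Fin.lastCases ?_ (fun k => ?_) k
    · simp only [hw, Fin.snoc_last, hz, scaledBound]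
      linarith [Real.sqrt_nonneg (y 0)]
    · simp only [hw, Fin.snoc_castSucc, scaledBound]
      have hd : |d k| ≤ √(y 0) := by
        refine Real.abs_le_sqrt ?_
        rw [← h0]
        exact single_le_sum (f := fun k => d k ^ 2) (fun _ _ => sq_nonneg _) (mem_univ k)
      linarith [abs_add_le (c k) (d k), h3 k, abs_nonneg (scaledAdded G y)]
  have hM0 : 0 ≤ scaledBound G y := (abs_nonneg _).trans (hM (Fin.last n))
  have hSpos := hs.trans_le hsS
  have hmain := abs_neg_two_mul_log_elRatio_sub_le n.succ_pos w hM hSpos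
    (by rw [hT]; exact hsmall.trans hsS)
  rw [hT] at hmain
  set S := ∑ k, w k ^ 2 with hSdef
  set T := scaledSum G y with hTdef
  set M := scaledBound G y with hMdef
  have b1 : 64 * |T| ^ 4 * M ^ 2 / S ^ 3 ≤ 64 * |T| ^ 4 * M ^ 2 / s ^ 3 := by gcongr
  have b2 : 32 * |T| ^ 3 * M / S ^ 2 ≤ 32 * |T| ^ 3 * M / s ^ 2 := by gcongr
  have b3 : |T ^ 2 / S - G ^ 2 / v| ≤ |T ^ 2 - G ^ 2| / s +
      G ^ 2 * (|y 2 - v| + sqDefect y + scaledAdded G y ^ 2) / (s * v) := by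
    -- Numerator and denominator are changed one at a time.
    have e : T ^ 2 / S - G ^ 2 / v = (T ^ 2 - G ^ 2) / S + G ^ 2 * (v - S) / (S * v) := by
      field_simp
      ring
    rw [e]
    refine (abs_add_le _ _).trans (add_le_add ?_ ?_)
    · rw [abs_div, abs_of_pos hSpos]
      gcongr
    · rw [abs_div, abs_mul, abs_of_nonneg (sq_nonneg G), abs_of_pos (mul_pos hSpos hv),
        abs_sub_comm v S]
      have hnn := (abs_nonneg _).trans hSv
      gcongr
  have e : -2 * Real.log (elRatio w) - G ^ 2 / v =
      (-2 * Real.log (elRatio w) - T ^ 2 / S) + (T ^ 2 / S - G ^ 2 / v) := by ring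
  rw [e, wilksError]
  exact (abs_add_le _ _).trans (add_le_add (hmain.trans (add_le_add b1 b2)) b3)

section Continuity

theorem continuous_scaledAdded :
    Continuous fun p : (Fin 6 → ℝ) × ℝ => scaledAdded p.2 p.1 := by
  unfold scaledAdded
  fun_prop

theorem continuous_scaledSum : Continuous fun p : (Fin 6 → ℝ) × ℝ => scaledSum p.2 p.1 := by
  unfold scaledSum scaledAdded
  fun_prop

theorem continuous_scaledBound :
    Continuous fun p : (Fin 6 → ℝ) × ℝ => scaledBound p.2 p.1 := by
  unfold scaledBound scaledAdded
  fun_prop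

theorem continuous_sqDefect : Continuous fun p : (Fin 6 → ℝ) × ℝ => sqDefect p.1 := by
  unfold sqDefect
  fun_prop

/-- The error is small near the limit of the six quantities, uniformly for bounded `G`. -/
theorem eventually_wilksError_lt {v ε : ℝ} (hv : 0 < v) (hε : 0 < ε) (K : ℝ) :
    ∀ᶠ y in nhds (![0, 0, v, 0, 0, 0] : Fin 6 → ℝ), ∀ G ∈ Set.Icc (-K) K,
      0 < y 2 - sqDefect y ∧ 4 * scaledBound G y * |scaledSum G y| ≤ y 2 - sqDefect y ∧
        wilksError v G y < ε := by
  -- Compactness in `G` makes joint continuity at each `G` uniform; at the limit point the error is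
  -- `0` for every `G`.
  refine isCompact_Icc.eventually_forall_of_forall_eventually fun G _ => ?_
  have cA := (continuous_scaledAdded).continuousAt (x := (![0, 0, v, 0, 0, 0], G))
  have cS := (continuous_scaledSum).continuousAt (x := (![0, 0, v, 0, 0, 0], G))
  have cB := (continuous_scaledBound).continuousAt (x := (![0, 0, v, 0, 0, 0], G))
  have c2 : ContinuousAt (fun p : (Fin 6 → ℝ) × ℝ => p.1 2) (![0, 0, v, 0, 0, 0], G) := by fun_prop
  have cG : ContinuousAt (fun p : (Fin 6 → ℝ) × ℝ => p.2) (![0, 0, v, 0, 0, 0], G) := by fun_prop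
  have cE := (continuous_sqDefect).continuousAt (x := (![0, 0, v, 0, 0, 0], G))
  have cD : ContinuousAt (fun p : (Fin 6 → ℝ) × ℝ => p.1 2 - sqDefect p.1)
      (![0, 0, v, 0, 0, 0], G) := c2.sub cE
  have vA : scaledAdded G ![0, 0, v, 0, 0, 0] = 0 := by simp [scaledAdded]
  have vS : scaledSum G ![0, 0, v, 0, 0, 0] = G := by simp [scaledSum, vA]
  have vB : scaledBound G ![0, 0, v, 0, 0, 0] = 0 := by simp [scaledBound, vA]
  have vE : sqDefect ![0, 0, v, 0, 0, 0] = 0 := by simp [sqDefect]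
  have v2 : (![0, 0, v, 0, 0, 0] : Fin 6 → ℝ) 2 = v := by simp
  have vD : (![0, 0, v, 0, 0, 0] : Fin 6 → ℝ) 2 - sqDefect ![0, 0, v, 0, 0, 0] = v := by
    rw [vE, v2, sub_zero]
  have cW : ContinuousAt (fun p : (Fin 6 → ℝ) × ℝ => wilksError v p.2 p.1)
      (![0, 0, v, 0, 0, 0], G) := by
    unfold wilksError
    refine ((ContinuousAt.div ?_ (cD.pow 3) ?_).add (ContinuousAt.div ?_ (cD.pow 2) ?_)).add
      ((ContinuousAt.div ?_ cD ?_).add (ContinuousAt.div ?_ (cD.mul continuousAt_const) ?_))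
    · exact (continuousAt_const.mul (cS.abs.pow 4)).mul (cB.pow 2)
    · change ((![0, 0, v, 0, 0, 0] : Fin 6 → ℝ) 2 - sqDefect ![0, 0, v, 0, 0, 0]) ^ 3 ≠ 0
      rw [vD]
      exact pow_ne_zero 3 hv.ne'
    · exact (continuousAt_const.mul (cS.abs.pow 3)).mul cB
    · change ((![0, 0, v, 0, 0, 0] : Fin 6 → ℝ) 2 - sqDefect ![0, 0, v, 0, 0, 0]) ^ 2 ≠ 0
      rw [vD]
      exact pow_ne_zero 2 hv.ne'
    · exact ((cS.pow 2).sub (cG.pow 2)).abs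
    · change (![0, 0, v, 0, 0, 0] : Fin 6 → ℝ) 2 - sqDefect ![0, 0, v, 0, 0, 0] ≠ 0
      rw [vD]
      exact hv.ne'
    · exact (cG.pow 2).mul (((c2.sub continuousAt_const).abs.add cE).add (cA.pow 2))
    · change ((![0, 0, v, 0, 0, 0] : Fin 6 → ℝ) 2 - sqDefect ![0, 0, v, 0, 0, 0]) * v ≠ 0
      rw [vD]
      exact mul_ne_zero hv.ne' hv.ne'
  have vW : wilksError v G ![0, 0, v, 0, 0, 0] = 0 := by
    simp only [wilksError, vS, vB, vE, vA, v2]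
    simp
  have e1 : ∀ᶠ p : (Fin 6 → ℝ) × ℝ in nhds (![0, 0, v, 0, 0, 0], G), 0 < p.1 2 - sqDefect p.1 :=
    continuousAt_const.eventually_lt cD (by rw [vD]; exact hv)
  have e2 : ∀ᶠ p : (Fin 6 → ℝ) × ℝ in nhds (![0, 0, v, 0, 0, 0], G),
      4 * scaledBound p.2 p.1 * |scaledSum p.2 p.1| < p.1 2 - sqDefect p.1 :=
    ((continuousAt_const.mul cB).mul cS.abs).eventually_lt cD (by
      change 4 * scaledBound G ![0, 0, v, 0, 0, 0] * |scaledSum G ![0, 0, v, 0, 0, 0]| < _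
      rw [vD, vB]
      simpa using hv)
  have e3 : ∀ᶠ p : (Fin 6 → ℝ) × ℝ in nhds (![0, 0, v, 0, 0, 0], G), wilksError v p.2 p.1 < ε :=
    cW.eventually_lt continuousAt_const (by rw [vW]; exact hε)
  filter_upwards [e1, e2, e3] with p h1 h2 h3
  exact ⟨h1, h2.le, h3⟩

end Continuity

/-! ### Wilks' theorem for the adjusted ratio. -/

theorem measurable_pseudoValue {Ω : Type*} [MeasurableSpace Ω] {X : ℕ → Ω → ℝ}
    (hX : ∀ i, Measurable (X i)) (r n : ℕ) (k : Fin n) :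
    Measurable fun ω => pseudoValue r n (fun i => X i ω) k := by
  have h : ∀ t : Finset ℕ, Measurable fun ω => sampleMax t fun i => X i ω := fun t =>
    (measurable_sampleMax t).comp (measurable_pi_lambda _ hX)
  simp only [pseudoValue, pwmEstimator]
  fun_prop

theorem aemeasurable_adjLogRatio {Ω : Type*} [MeasurableSpace Ω] {P : Measure Ω} {n : ℕ}
    {V : Ω → Fin n → ℝ} {u : Ω → ℝ} (hV : ∀ k, AEMeasurable (fun ω => V ω k) P)
    (hu : AEMeasurable u P) (b : ℝ) : AEMeasurable (fun ω => adjLogRatio (V ω) (u ω) b) P := by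
  refine Real.measurable_log.comp_aemeasurable (measurable_elRatio.comp_aemeasurable
    (aemeasurable_pi_lambda _ fun k => ?_))
  refine Fin.lastCases ?_ (fun k => ?_) k
  · simpa only [Fin.snoc_last] using hu.sub_const b
  · simpa only [Fin.snoc_castSucc] using (hV k).sub_const b

/-- Rescaling the values does not change the adjusted ratio. -/
theorem adjLogRatio_eq_div {n : ℕ} (V : Fin n → ℝ) (u b : ℝ) {c : ℝ} (hc : c ≠ 0) :
    adjLogRatio V u b =
      Real.log (elRatio (Fin.snoc (fun k => (V k - b) / c) ((u - b) / c) : Fin (n + 1) → ℝ)) := by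
  rw [adjLogRatio, ← elRatio_div_const _ hc]
  congr 2
  ext k
  refine Fin.lastCases ?_ (fun k => ?_) k
  · simp only [Fin.snoc_last]
  · simp only [Fin.snoc_castSucc]

/-- Wilks' theorem for an added value `u n` with
`(u n - β) / √n = - α n * ∑ (V k - β) / √n - b n`, where `α n` and `b n` tend to zero in
probability. -/
theorem tendstoInDistribution_adjLogRatio {Ω : Type*} [MeasurableSpace Ω] {P : Measure Ω}
    [IsProbabilityMeasure P] {X : ℕ → Ω → ℝ} (hX : ∀ i, Measurable (X i))
    (hindep : iIndepFun X P) {ν : Measure ℝ} [IsProbabilityMeasure ν] [NullSingletonClass ν]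
    (hlaw : ∀ i, P.map (X i) = ν) {r : ℕ} (hr : 1 ≤ r)
    (hmom : MemLp (pwmKernel r) 2 (Measure.pi fun _ : Fin (r + 1) => ν))
    (hvar : 0 < variance (pwmProjection ν r) ν)
    {u α b : ℕ → Ω → ℝ} (hu : ∀ n, AEMeasurable (u n) P)
    (hα : TendstoInMeasure P α atTop fun _ => (0 : ℝ))
    (hb : TendstoInMeasure P b atTop fun _ => (0 : ℝ))
    (hadd : ∀ n ω, 0 < n → (u n ω - pwm ν r) / √(n : ℝ) =
      -(α n ω) * ((∑ k : Fin n, (pseudoValue r n (fun i => X i ω) k - pwm ν r)) / √(n : ℝ)) -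
        b n ω) :
    TendstoInDistribution (fun (n : ℕ) ω =>
        -2 * adjLogRatio (pseudoValue r n fun i => X i ω) (u n ω) (pwm ν r))
      atTop (fun u : ℝ => u ^ 2) (fun _ => P) (gaussianReal 0 1) := by
  have hg : Measurable (centredProjection ν r) := measurable_centredProjection
  have hg2 := memLp_centredProjection hmom
  have hg0 := integral_centredProjection hmom
  have hv := integral_centredProjection_sq hmom
  set g := centredProjection ν r with hgdef
  set v := variance (pwmProjection ν r) ν with hvdef
  have hlim := tendstoInDistribution_sq_sum_div hX hindep hlaw hg hg0 (by rwa [hv])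
  rw [hv] at hlim
  -- Slutsky: only the difference from the squared normalized sum must vanish in probability.
  refine tendstoInDistribution_of_tendstoInMeasure_sub _ _ hlim ?_ fun n =>
    (aemeasurable_adjLogRatio (fun k => (measurable_pseudoValue hX r n k).aemeasurable)
      (hu n) _).const_mul _
  rw [tendstoInMeasure_iff_norm]
  intro ε hε
  let R : ℕ → Ω → ℕ → ℝ := fun n ω => jackknife r n (sampleRemainder ν r fun i => X i ω)
  let T : ℕ → Ω → ℝ := fun n ω => (∑ k ∈ range n, g (X k ω)) / √(n : ℝ)
  -- The order matches the coordinates `y 0`, …, `y 5` of the error bound.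
  let Y : Fin 6 → ℕ → Ω → ℝ := ![
    fun n ω => (∑ k ∈ range n, R n ω k ^ 2) / (n : ℝ),
    fun n ω => (∑ k ∈ range n, R n ω k) / √(n : ℝ),
    fun n ω => (∑ k ∈ range n, g (X k ω) ^ 2) / (n : ℝ),
    fun n ω => sampleMax (range n) (fun k => |g (X k ω)|) / √(n : ℝ), α, b]
  have hY : ∀ j, TendstoInMeasure P (Y j) atTop
      fun _ => (![0, 0, v, 0, 0, 0] : Fin 6 → ℝ) j := by
    have h2 := tendstoInMeasure_mean_sq hX hindep hlaw hg hg2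
    rw [hv] at h2
    have h0 := tendstoInMeasure_mean_sq_jackknife_sampleRemainder hr hX hindep hlaw hmom
    have h1 := tendstoInMeasure_sum_jackknife_sampleRemainder hr hX hindep hlaw hmom
    have h3 := tendstoInMeasure_sampleMax_div_sqrt hX hindep hlaw hg hg2
    intro j
    fin_cases j
    exacts [h0, h1, h2, h3, hα, hb]
  have hT : ∀ δ : ENNReal, 0 < δ → ∃ K : ℝ, ∀ n, P {ω | K < |T n ω|} ≤ δ := by
    intro δ hδ
    have hK : Tendsto (fun K : ℝ => ENNReal.ofReal (v / K ^ 2)) atTop (nhds 0) := by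
      have h := ENNReal.tendsto_ofReal ((tendsto_const_nhds (x := v)).div_atTop
        (tendsto_pow_atTop (α := ℝ) two_ne_zero))
      rwa [ENNReal.ofReal_zero] at h
    obtain ⟨K, hK1, hK2⟩ := ((ENNReal.tendsto_nhds_zero.1 hK δ hδ).and
      (eventually_gt_atTop 0)).exists
    refine ⟨K, fun n => ?_⟩
    have h := measure_lt_abs_sum_div_sqrt_le hX hindep hlaw hg hg2 hg0 n hK2
    rw [hv] at h
    exact h.trans hK1
  have hmain := tendsto_measure_not_of_tight (Good := fun n ω =>
    |-2 * adjLogRatio (pseudoValue r n fun i => X i ω) (u n ω) (pwm ν r) - T n ω ^ 2 / v| < ε)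
    hT hY fun K => ⟨_, eventually_wilksError_lt hvar hε K, ?_⟩
  · refine hmain.congr fun n => ?_
    congr 1
    ext ω
    simp only [not_lt, Set.mem_ofPred_eq, Pi.sub_apply, Pi.zero_apply, sub_zero,
      Real.norm_eq_abs, T]
  filter_upwards [eventually_ge_atTop (r + 2)] with n hn ω hTK hU
  obtain ⟨hs, hsmall, herr⟩ := hU (T n ω) ⟨(abs_le.1 hTK).1, (abs_le.1 hTK).2⟩
  refine lt_of_le_of_lt ?_ herr
  have hn0 : (0 : ℝ) < n := by exact_mod_cast (by omega : 0 < n)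
  have hsq : 0 < √(n : ℝ) := Real.sqrt_pos.2 hn0
  have hsplit : ∀ k : Fin n, (pseudoValue r n (fun i => X i ω) k - pwm ν r) / √(n : ℝ) =
      g (X k ω) / √(n : ℝ) + R n ω k / √(n : ℝ) := by
    intro k
    rw [pseudoValue_eq (ν := ν) hn]
    simp only [R, hgdef]
    ring
  rw [adjLogRatio_eq_div _ _ _ hsq.ne']
  simp only [hsplit]
  have hG : ∑ k : Fin n, g (X k ω) / √(n : ℝ) = T n ω := by
    rw [Fin.sum_univ_eq_sum_range (fun k => g (X k ω) / √(n : ℝ)), ← sum_div]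
  have h1 : ∑ k : Fin n, R n ω k / √(n : ℝ) = Y 1 n ω := by
    rw [Fin.sum_univ_eq_sum_range (fun k => R n ω k / √(n : ℝ)), ← sum_div]
    rfl
  refine abs_neg_two_mul_log_elRatio_snoc_sub_le hvar hG ?_ h1 ?_ ?_ ?_ ?_ hs hsmall
  · simp only [div_pow, Real.sq_sqrt hn0.le]
    rw [Fin.sum_univ_eq_sum_range (fun k => R n ω k ^ 2 / (n : ℝ)), ← sum_div]
    rfl
  · simp only [div_pow, Real.sq_sqrt hn0.le]
    rw [Fin.sum_univ_eq_sum_range (fun k => g (X k ω) ^ 2 / (n : ℝ)), ← sum_div]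
    rfl
  · intro k
    rw [abs_div, abs_of_pos hsq]
    exact div_le_div_of_nonneg_right
      (le_sampleMax (fun k => |g (X k ω)|) (mem_range.2 k.2)) hsq.le
  · exact div_nonneg (sampleMax_nonneg fun _ _ => abs_nonneg _) hsq.le
  · rw [hadd n ω (by omega), sum_div, sum_congr rfl fun k _ => hsplit k, sum_add_distrib, hG, h1]
    rfl

theorem theorem2 {Ω : Type*} [MeasurableSpace Ω] (P : Measure Ω) [IsProbabilityMeasure P]
    (X : ℕ → Ω → ℝ) (hX : ∀ i, Measurable (X i))
    (hindep : iIndepFun X P)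
    (ν : Measure ℝ) (hlaw : ∀ i, P.map (X i) = ν)
    (hcont : Continuous (cdf ν))
    (r : ℕ) (hr : 1 ≤ r)
    (hmom : MemLp (pwmKernel r) 2 (Measure.pi fun _ : Fin (r + 1) => ν))
    (hvar : 0 < variance (pwmProjection ν r) ν)
    (a : ℕ → Ω → ℝ) (ha : ∀ n, AEMeasurable (a n) P) (hapos : ∀ n, ∀ᵐ ω ∂P, 0 < a n ω)
    (hasmall : TendstoInMeasure P (fun n ω => a n ω / (n : ℝ) ^ (2 / 3 : ℝ)) atTop
      (fun _ => (0 : ℝ))) :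
    TendstoInDistribution
      (fun (n : ℕ) ω =>
        -2 * adjLogRatio (pseudoValue r n fun i => X i ω)
          (centredAddedValue (a n ω) (pwm ν r) (pseudoValue r n fun i => X i ω)) (pwm ν r))
      atTop (fun u : ℝ => u ^ 2) (fun _ => P) (gaussianReal 0 1) ∧
    (TendstoInMeasure P (fun n ω => pwm ν r * a n ω / (n : ℝ) ^ (1 / 2 : ℝ)) atTop
        (fun _ => (0 : ℝ)) →
      TendstoInDistribution
        (fun (n : ℕ) ω =>
          -2 * adjLogRatio (pseudoValue r n fun i => X i ω)
            (addedValue (a n ω) (pseudoValue r n fun i => X i ω)) (pwm ν r))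
        atTop (fun u : ℝ => u ^ 2) (fun _ => P) (gaussianReal 0 1)) := by
  have : IsProbabilityMeasure ν :=
    hlaw 0 ▸ Measure.isProbabilityMeasure_map (hX 0).aemeasurable
  have : NullSingletonClass ν := nullSingletonClass_of_continuous_cdf hcont
  -- `n ^ (2 / 3) ≤ n` for `n ≥ 1`.
  have hα : TendstoInMeasure P (fun n ω => a n ω / (n : ℝ)) atTop fun _ => (0 : ℝ) := by
    refine TendstoInMeasure.of_abs_le_add hasmall tendsto_const_nhds ?_
    filter_upwards [eventually_ge_atTop 1] with n hn ω
    have hn1 : (1 : ℝ) ≤ n := by exact_mod_cast hn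
    rw [add_zero, abs_div, abs_div, abs_of_nonneg (by positivity : (0 : ℝ) ≤ n),
      abs_of_nonneg (by positivity : (0 : ℝ) ≤ (n : ℝ) ^ (2 / 3 : ℝ))]
    refine div_le_div_of_nonneg_left (abs_nonneg _) (by positivity) ?_
    calc (n : ℝ) ^ (2 / 3 : ℝ) ≤ (n : ℝ) ^ (1 : ℝ) :=
          Real.rpow_le_rpow_of_exponent_le hn1 (by norm_num)
      _ = n := Real.rpow_one _
  have hV : ∀ n (k : Fin n), AEMeasurable (fun ω => pseudoValue r n (fun i => X i ω) k) P :=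
    fun n k => (measurable_pseudoValue hX r n k).aemeasurable
  refine ⟨?_, fun hb => ?_⟩
  · refine tendstoInDistribution_adjLogRatio hX hindep hlaw hr hmom hvar (fun n => ?_) hα
      (b := fun _ _ => 0) ?_ fun n ω hn => ?_
    · simp only [centredAddedValue, addedValue]
      have := ha n
      have := hV n
      fun_prop
    · rw [tendstoInMeasure_iff_norm]
      intro ε hε
      simp [not_le.2 hε]
    · simp only [centredAddedValue, addedValue]
      ring
  · refine tendstoInDistribution_adjLogRatio hX hindep hlaw hr hmom hvar (fun n => ?_) hα
      -- Here `u - β = -(a / n) ∑ (V_k - β) - β a - β`; the last two terms, divided by `√n`, form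
      -- `b`.
      (b := fun n ω => pwm ν r * a n ω / (n : ℝ) ^ (1 / 2 : ℝ) + pwm ν r / √(n : ℝ)) ?_
      fun n ω hn => ?_
    · simp only [addedValue]
      have := ha n
      have := hV n
      fun_prop
    · refine TendstoInMeasure.of_abs_le_add (c := fun n : ℕ => |pwm ν r| / √(n : ℝ)) hb
        (tendsto_const_nhds.div_atTop
          (Real.tendsto_sqrt_atTop.comp tendsto_natCast_atTop_atTop))
        (Eventually.of_forall fun n ω => ?_)
      refine (abs_add_le _ _).trans (le_of_eq ?_)
      rw [abs_div (pwm ν r), abs_of_nonneg (Real.sqrt_nonneg _)]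
    · have hn0 : (n : ℝ) ≠ 0 := by exact_mod_cast hn.ne'
      rw [← Real.sqrt_eq_rpow]
      simp only [addedValue, sum_sub_distrib, sum_const, card_univ, Fintype.card_fin,
        nsmul_eq_mul]
      have : √(n : ℝ) ≠ 0 := (Real.sqrt_pos.2 (by exact_mod_cast hn)).ne'
      field_simp
      ring
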